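/- Let $N=\mathbb Z^{n+1}$ with dual lattice $M=\mathbb Z^{n+1}$, and let $\Delta\subseteq\mathbb R^n$ be a lattice polytope (the convex hull of finitely many points of $\mathbb Z^n$). Put $\sigma:=\mathrm{cone}(\Delta)\subseteq N_{\mathbb R}=\mathbb R^{n+1}$, the cone generated by $\Delta\times\{1\}$, with fundamental generators $a^\nu=(v^\nu,1)$, where the $v^\nu$ are the vertices of $\Delta$. Let $\sigma^\vee=\{r\in M_{\mathbb R}\mid \langle\sigma,r\rangle\ge 0\}$. For $R\in M$ and faces $\tau\le\sigma$ put $K^R_\tau:=\sigma^\vee\cap(R-\mathrm{int}\,\tau^\vee)\cap M$, and let $V^R_\bullet$ be the homological system on the face fan of $\sigma$ (all faces $\tau\le\sigma$, including $0$ and $\sigma$) given by $$V^R_\tau:=\bigcap_{a^\nu\in\tau}\mathrm{span}_{\mathbb C}\big(K^R_{a^\nu}\big)\subseteq M_{\mathbb C},\qquad V^R_0:=M_{\mathbb C},$$ with the inclusions $V^R_\sigma\subseteq V^R_\tau$ for $\tau\le\sigma$ as face maps; here $K^R_{a^\nu}$ is $K^R_\tau$ for the ray $\tau=\mathbb R_{\ge0}a^\nu$.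 Fix an orientation of each face, and for faces $\tau,\tau'$ with $\dim\tau'=\dim\tau+1$ let $\varepsilon(\tau,\tau')=\pm1$ if $\tau$ is a facet of $\tau'$, according to whether the orientation of $\tau$ agrees with the one inherited from $\tau'$, and $\varepsilon(\tau,\tau')=0$ otherwise. Let $C_k:=\bigoplus_{\dim\tau=k}V^R_\tau$ for $k\ge0$, with differential $C_{k+1}\to C_k$ whose component $V^R_{\tau'}\to V^R_\tau$ is $\varepsilon(\tau,\tau')$ times the inclusion if $\tau\le\tau'$, and $0$ otherwise. **Proposition.** If $R\in M$ is a degree such that $R\not\le 1$ on $\Delta$ (that is, $\langle (x,1),R\rangle>1$ for some $x\in\Delta$), then, for any choice of orientations, the complex $$\cdots\to C_2\to C_1\to C_0\to 0$$ is exact (in all degrees, including $C_0$). -/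

import Mathlib

noncomputable section

/-- The real span of a polyhedral cone in `ℝ^d`. -/
abbrev coneSpan {d : ℕ} (τ : PointedCone ℝ (Fin d → ℝ)) : Submodule ℝ (Fin d → ℝ) :=
  Submodule.span ℝ (τ : Set (Fin d → ℝ))

/-- The dual cone `τ^∨ = {r | ⟨x, r⟩ ≥ 0 for all x ∈ τ}`, for the standard pairing on `ℝ^d`. -/
def dualCone {d : ℕ} (τ : PointedCone ℝ (Fin d → ℝ)) : Set (Fin d → ℝ) :=
  {r | ∀ x ∈ τ, 0 ≤ x ⬝ᵥ r}

/-- Let `τ` be a facet of `σ`, with orientations `oτ` and `oσ` of their spans. The orientation of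
`τ` is the one inherited from `σ` if, for a form `ω` representing `oσ` and a vector `w ∈ σ` not in
the span of `τ` (so that `-w` points out of `σ` across `τ`), the form `ω(-w, ·)`, restricted to the
span of `τ`, represents `oτ` ("outward normal first"). Here `incl` is the inclusion of spans. -/
def InducesOrientation {d k : ℕ} {τ σ : PointedCone ℝ (Fin d → ℝ)} (h : τ ≤ σ)
    (oτ : Orientation ℝ (coneSpan τ) (Fin k)) (oσ : Orientation ℝ (coneSpan σ) (Fin (k + 1))) :
    Prop :=
  ∃ (w : coneSpan σ) (ω : (coneSpan σ) [⋀^Fin (k + 1)]→ₗ[ℝ] ℝ) (hω : ω ≠ 0)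
    (hτ : (ω.curryLeft (-w)).compLinearMap (Submodule.inclusion (Submodule.span_mono h)) ≠ 0),
    (w : Fin d → ℝ) ∈ σ ∧ (w : Fin d → ℝ) ∉ coneSpan τ ∧
    rayOfNeZero ℝ ω hω = oσ ∧ rayOfNeZero ℝ _ hτ = oτ

/-- A lattice polytope in `ℝ^n`: the convex hull of a finite set of points of `ℤ^n`. -/
structure LatticePolytope (n : ℕ) where
  carrier : Set (Fin n → ℝ)
  exists_finset : ∃ S : Finset (Fin n → ℤ),
    carrier = convexHull ℝ ((fun s (i : Fin n) => (s i : ℝ)) '' (S : Set (Fin n → ℤ)))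

/-- The embedding `x ↦ (x, 1)` of `ℝ^n` at height one in `N_ℝ = ℝ^(n+1)`. -/
def heightOne {n : ℕ} (x : Fin n → ℝ) : Fin (n + 1) → ℝ :=
  Fin.snoc (α := fun _ => ℝ) x 1

/-- A lattice vector of `ℤ^d`, regarded in `ℝ^d`. -/
def latticeReal {d : ℕ} (r : Fin d → ℤ) : Fin d → ℝ := fun i => (r i : ℝ)

/-- A lattice vector of `ℤ^d`, regarded in `ℂ^d`. -/
def latticeComplex {d : ℕ} (r : Fin d → ℤ) : Fin d → ℂ := fun i => (r i : ℂ)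

namespace LatticePolytope

variable {n : ℕ} (P : LatticePolytope n)

/-- The cone `σ = cone(Δ)` over `Δ × {1}`. -/
def cone : PointedCone ℝ (Fin (n + 1) → ℝ) :=
  PointedCone.hull ℝ (heightOne '' P.carrier)

/-- The `k`-dimensional cones of the face fan of `cone(Δ)`: the faces of `cone(Δ)`
(including `0` and the cone itself) whose span has dimension `k`. -/
def Face (k : ℕ) : Type :=
  {τ : PointedCone ℝ (Fin (n + 1) → ℝ) //
    τ.IsFaceOf P.cone ∧ Module.finrank ℝ (coneSpan τ) = k}

/-- The set of lattice points `K^R_τ = σ^∨ ∩ (R - int τ^∨) ∩ M`, for `σ = cone(Δ)`. -/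
def K (R : Fin (n + 1) → ℤ) (τ : PointedCone ℝ (Fin (n + 1) → ℝ)) : Set (Fin (n + 1) → ℤ) :=
  {r | latticeReal r ∈ dualCone P.cone ∧ latticeReal (R - r) ∈ interior (dualCone τ)}

/-- `V^R_τ ⊆ M_ℂ`: the intersection, over the fundamental generators `a = (v, 1)` of `cone(Δ)`
(`v` a vertex of `Δ`) that lie in `τ`, of the complex spans of `K^R_a`. -/
def V (R : Fin (n + 1) → ℤ) (τ : PointedCone ℝ (Fin (n + 1) → ℝ)) :
    Submodule ℂ (Fin (n + 1) → ℂ) :=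
  ⨅ v ∈ {v | v ∈ P.carrier.extremePoints ℝ ∧ heightOne v ∈ τ},
    Submodule.span ℂ (latticeComplex '' P.K R (PointedCone.hull ℝ {heightOne v}))

theorem V_anti (R : Fin (n + 1) → ℤ) {τ σ : PointedCone ℝ (Fin (n + 1) → ℝ)} (h : τ ≤ σ) :
    P.V R σ ≤ P.V R τ :=
  biInf_mono fun _ hv => ⟨hv.1, h hv.2⟩

theorem cone_eq (S : Finset (Fin n → ℤ))
    (hS : P.carrier = convexHull ℝ ((fun s (i : Fin n) => (s i : ℝ)) '' (S : Set (Fin n → ℤ)))) :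
    P.cone = PointedCone.hull ℝ
      (Set.range fun s : S => heightOne (fun i => ((s : Fin n → ℤ) i : ℝ))) := by
  apply le_antisymm
  · refine Submodule.span_le.2 ?_
    rintro _ ⟨x, hx, rfl⟩
    rw [hS] at hx
    have hconv : Convex ℝ {x : Fin n → ℝ | heightOne x ∈ PointedCone.hull ℝ
        (Set.range fun s : S => heightOne (fun i => ((s : Fin n → ℤ) i : ℝ)))} := by
      intro x hx y hy a b ha hb hab
      have : heightOne (a • x + b • y) = a • heightOne x + b • heightOne y := by
        funext i
        refine Fin.lastCases ?_ (fun j => ?_) i <;> simp [heightOne, hab]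
      simp only [Set.mem_ofPred_eq] at hx hy ⊢
      rw [this]
      exact add_mem (PointedCone.smul_mem _ ha hx) (PointedCone.smul_mem _ hb hy)
    refine convexHull_min ?_ hconv hx
    rintro _ ⟨s, hs, rfl⟩
    exact Submodule.subset_span ⟨⟨s, hs⟩, rfl⟩
  · refine Submodule.span_le.2 ?_
    rintro _ ⟨s, rfl⟩
    refine Submodule.subset_span ⟨_, ?_, rfl⟩
    rw [hS]
    exact subset_convexHull ℝ _ ⟨s, s.2, rfl⟩

/-- The face fan is finite. -/
instance finite_face (k : ℕ) : Finite (P.Face k) := by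
  obtain ⟨S, hS⟩ := P.exists_finset
  let a : S → Fin (n + 1) → ℝ := fun s => heightOne (fun i => ((s : Fin n → ℤ) i : ℝ))
  have hc : P.cone = PointedCone.hull ℝ (Set.range a) := P.cone_eq S hS
  have ha : ∀ s, a s ∈ P.cone := fun s => hc ▸ Submodule.subset_span ⟨s, rfl⟩
  have key : ∀ τ τ' : PointedCone ℝ (Fin (n + 1) → ℝ), τ.IsFaceOf P.cone →
      {s | a s ∈ τ} ⊆ {s | a s ∈ τ'} → τ ≤ τ' := by
    intro τ τ' hτ hsub x hx
    have hx' := hτ.le hx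
    rw [hc] at hx'
    obtain ⟨c, rfl⟩ := (Submodule.mem_span_range_iff_exists_fun _).1 hx'
    refine Submodule.sum_mem _ fun s _ => ?_
    rcases (c s).2.eq_or_lt with h0 | h0
    · have : c s = 0 := Subtype.ext h0.symm
      simp [this]
    · exact Submodule.smul_mem _ _ (hsub
        (hτ.mem_of_sum_smul_mem (c := fun s => (c s : ℝ)) ha (fun s => (c s).2) hx s h0))
  refine Finite.of_injective (fun τ : P.Face k => {s | a s ∈ τ.1}) fun τ τ' h => ?_
  exact Subtype.ext (le_antisymm (key _ _ τ.2.1 h.le) (key _ _ τ'.2.1 h.ge))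

instance fintype_face (k : ℕ) : Fintype (P.Face k) := Fintype.ofFinite _

/-- A choice of an orientation for each cone of the face fan. -/
abbrev FaceOrientations : Type :=
  ∀ (k : ℕ) (τ : P.Face k), Orientation ℝ (coneSpan τ.1) (Fin k)

variable {P}

open Classical in
/-- The number `ε(τ, σ)`: it is `±1` if `τ` is a facet of `σ`, according to whether the orientation
of `τ` is the one inherited from `σ`, and `0` otherwise. -/
def FaceOrientations.sign (o : P.FaceOrientations) {k : ℕ} (τ : P.Face k) (σ : P.Face (k + 1)) :
    ℤ :=
  if h : τ.1 ≤ σ.1 then (if InducesOrientation h (o k τ) (o (k + 1) σ) then 1 else -1) else 0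

variable (P)

/-- The `k`-th term `⨁_{dim τ = k} V^R_τ` of the complex of the homological system `V^R`
(a finite direct sum, written as a product). -/
abbrev Chain (R : Fin (n + 1) → ℤ) (k : ℕ) : Type := ∀ τ : P.Face k, P.V R τ.1

open Classical in
/-- The differential `C_{k+1} → C_k` of the complex of `V^R`: its component from `V^R_σ` to `V^R_τ`
is `ε(τ, σ)` times the inclusion if `τ` is a facet of `σ`, and `0` otherwise. -/
def differential (o : P.FaceOrientations) (R : Fin (n + 1) → ℤ) (k : ℕ) :
    P.Chain R (k + 1) →ₗ[ℂ] P.Chain R k :=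
  LinearMap.pi fun τ => ∑ σ : P.Face (k + 1),
    if h : τ.1 ≤ σ.1 then
      o.sign τ σ • (Submodule.inclusion (P.V_anti R h)).comp (LinearMap.proj σ)
    else 0

end LatticePolytope

end

/-! Let `excess R` be R minus the height; the hypothesis says that it is positive somewhere on σ. At
a fundamental generator a, the set K^R_a is empty if the excess is negative, and it spans all of M_ℂ
if the excess is positive; nothing need be known where the excess is zero. Hence V_τ = 0 as soon as
the excess is negative somewhere on τ (`V_eq_bot`), and otherwise V_τ = V_ρ for the face ρ of τ on
which the excess vanishes (`V_eq_of_mem_positiveFaces`). The face lattice thus splits into faces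
with zero coefficients and, for each ρ, the set `positiveFaces` of faces containing ρ on which the
excess is positive off ρ; on each such set the coefficients are constant.

Exactness follows from an acyclic matching in the sense of discrete Morse theory (`Collapsible`):
matched faces are consecutive and have equal coefficients, so a cycle can be cleared from the top of
the face lattice downwards by subtracting boundaries (`exists_sub_differential_eq_zero`).

The matching on the faces where a form f is positive off ρ is built in `collapsible_positiveFaces`,
by induction on dim σ − dim ρ. Choose h exposing ρ and sort the faces by the minimum of f/h. Faces
whose minimum is the maximum T over σ lie in the face {f = T h}, of smaller dimension; those with a
smaller minimum t are sorted further by the face μ where it is attained, and are the faces on which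
f − t h is positive off μ. Both cases are smaller instances of the same statement.

That the differential squares to zero comes from the diamond property of the face lattice and the
antisymmetry of top forms. -/

noncomputable section

/-! ### Collapsible subsets of a graded poset -/

/-- A set of elements of a graded poset that can be exhausted, from the bottom up, by single elements with
trivial coefficients and by pairs of consecutive elements with equal coefficients. -/
inductive Collapsible {α β : Type*} [PartialOrder α] [Bot β] (rk : α → ℕ) (V : α → β) :
    Set α → Prop
  | empty : Collapsible rk V ∅
  | single (a : α) (ha : V a = ⊥) : Collapsible rk V {a}
  | pair (a b : α) (hab : a ≤ b) (hrk : rk b = rk a + 1) (hV : V a = V b) :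
      Collapsible rk V {a, b}
  | union (A B : Set α) (hA : Collapsible rk V A) (hB : Collapsible rk V B)
      (hAB : ∀ a ∈ A, ∀ b ∈ B, ¬ b ≤ a) : Collapsible rk V (A ∪ B)

namespace Collapsible

variable {α β : Type*} [PartialOrder α] [Bot β] {rk : α → ℕ} {V : α → β}

/-- The patchwork principle for acyclic matchings: matchings on the fibres of a monotone map fit
together. A fibre over a maximal value has no element below the remaining ones, so it can be split
off by `union`. -/
theorem of_fibers {Q : Type*} [PartialOrder Q] (g : α → Q) {S : Set α} (hS : S.Finite)
    (hg : ∀ a ∈ S, ∀ b ∈ S, a ≤ b → g a ≤ g b)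
    (hfib : ∀ a ∈ S, Collapsible rk V {b ∈ S | g b = g a}) : Collapsible rk V S := by
  obtain ⟨m, hm⟩ : ∃ m, (g '' S).ncard = m := ⟨_, rfl⟩
  induction m using Nat.strong_induction_on generalizing S with
  | _ m ih =>
    rcases S.eq_empty_or_nonempty with rfl | hne
    · exact .empty
    · obtain ⟨q, hq⟩ := (hS.image g).exists_maximal (hne.image g)
      obtain ⟨a, ha, rfl⟩ := hq.1
      have hsub : {b ∈ S | g b ≠ g a} ⊆ S := Set.sep_subset _ _
      have h1 : Collapsible rk V {b ∈ S | g b ≠ g a} := by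
        refine ih _ ?_ (hS.subset hsub) (fun x hx y hy => hg x hx.1 y hy.1) ?_ rfl
        · rw [← hm]
          refine Set.ncard_lt_ncard ⟨Set.image_mono hsub, fun h => ?_⟩ (hS.image g)
          obtain ⟨b, hb, hba⟩ := h ⟨a, ha, rfl⟩
          exact hb.2 hba
        · intro x hx
          have := hfib x hx.1
          convert this using 1
          ext y
          constructor
          · rintro ⟨hy, hyx⟩
            exact ⟨hy.1, hyx⟩
          · rintro ⟨hy, hyx⟩
            exact ⟨⟨hy, hyx ▸ hx.2⟩, hyx⟩
      have h2 := union _ _ h1 (hfib a ha) (by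
        rintro x ⟨hx, hxa⟩ y ⟨hy, hya⟩ hyx
        have := hg y hy x hx hyx
        rw [hya] at this
        exact hxa (le_antisymm (hq.2 ⟨x, hx, rfl⟩ this) this))
      convert h2 using 1
      ext y
      by_cases hy : g y = g a <;> simp [hy]

theorem of_forall_eq_bot {S : Set α} (hS : S.Finite) (h : ∀ a ∈ S, V a = ⊥) :
    Collapsible rk V S := by
  refine of_fibers id hS (fun _ _ _ _ h => h) fun a ha => ?_
  convert single (rk := rk) a (h a ha) using 1
  ext y
  constructor
  · exact fun h => h.2
  · rintro rfl
    exact ⟨ha, rfl⟩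

end Collapsible

end

/-! ### Faces of finitely generated cones, exposing forms and ratios of forms -/

noncomputable section

namespace PointedCone

variable {d : ℕ}

local notation "E" => Fin d → ℝ

/-- Every face of a finitely generated cone is generated by the generators that it contains. -/
theorem IsFaceOf.eq_hull {s : Set E} (hs : s.Finite) {σ τ : PointedCone ℝ E}
    (hσ : σ = PointedCone.hull ℝ s) (hτ : τ.IsFaceOf σ) : τ = PointedCone.hull ℝ {a ∈ s | a ∈ τ} := by
  refine le_antisymm (fun x hx => ?_) (Submodule.span_le.2 fun a ha => ha.2)
  have hx' := hτ.le hx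
  have := hs.fintype
  rw [hσ, ← Subtype.range_coe (s := s)] at hx'
  obtain ⟨c, rfl⟩ := (Submodule.mem_span_range_iff_exists_fun _).1 hx'
  refine Submodule.sum_mem _ fun a _ => ?_
  rcases (c a).2.eq_or_lt with h0 | h0
  · have : c a = 0 := Subtype.ext h0.symm
    simp [this]
  · exact Submodule.smul_mem _ _ (Submodule.subset_span ⟨a.2, hτ.mem_of_sum_smul_mem
      (c := fun a => (c a : ℝ)) (fun a => hσ ▸ Submodule.subset_span a.2) (fun a => (c a).2) hx a h0⟩)

theorem IsFaceOf.fg {σ τ : PointedCone ℝ E} (hσ : σ.FG) (hτ : τ.IsFaceOf σ) : τ.FG := by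
  obtain ⟨s, hs⟩ := hσ
  rw [hτ.eq_hull s.finite_toSet hs.symm]
  exact Submodule.fg_span (s.finite_toSet.subset (Set.sep_subset _ _))

theorem finite_faces {σ : PointedCone ℝ E} (hσ : σ.FG) : {τ | IsFaceOf τ σ}.Finite := by
  obtain ⟨s, hs⟩ := hσ
  refine Set.Finite.of_finite_image (f := fun τ : PointedCone ℝ E => {a ∈ (s : Set E) | a ∈ τ})
    (s.finite_toSet.finite_subsets.subset ?_) ?_
  · rintro _ ⟨τ, -, rfl⟩
    exact Set.sep_subset _ _
  · intro τ hτ τ' hτ' h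
    rw [IsFaceOf.eq_hull s.finite_toSet hs.symm hτ, IsFaceOf.eq_hull s.finite_toSet hs.symm hτ']
    exact congrArg _ h

/-- The vectors of a span of a cone are differences of vectors of the cone. -/
theorem mem_coneSpan_iff {τ : PointedCone ℝ E} {x : E} :
    x ∈ coneSpan τ ↔ ∃ y ∈ τ, ∃ z ∈ τ, x = y - z := by
  constructor
  · intro hx
    induction hx using Submodule.span_induction with
    | mem x h => exact ⟨x, h, 0, zero_mem _, by simp⟩
    | zero => exact ⟨0, zero_mem _, 0, zero_mem _, by simp⟩
    | add x y _ _ hx hy =>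
      obtain ⟨a, ha, b, hb, rfl⟩ := hx
      obtain ⟨a', ha', b', hb', rfl⟩ := hy
      exact ⟨a + a', add_mem ha ha', b + b', add_mem hb hb', by abel⟩
    | smul c x _ hx =>
      obtain ⟨a, ha, b, hb, rfl⟩ := hx
      rcases le_total 0 c with hc | hc
      · exact ⟨c • a, smul_mem _ hc ha, c • b, smul_mem _ hc hb, smul_sub _ _ _⟩
      · refine ⟨(-c) • b, smul_mem _ (neg_nonneg.2 hc) hb, (-c) • a,
          smul_mem _ (neg_nonneg.2 hc) ha, ?_⟩
        module
  · rintro ⟨y, hy, z, hz, rfl⟩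
    exact sub_mem (Submodule.subset_span hy) (Submodule.subset_span hz)

theorem mem_coneSpan {τ : PointedCone ℝ E} {x : E} (hx : x ∈ τ) : x ∈ coneSpan τ :=
  Submodule.subset_span hx

theorem coneSpan_mono {τ σ : PointedCone ℝ E} (h : τ ≤ σ) : coneSpan τ ≤ coneSpan σ :=
  Submodule.span_mono h

/-- If x = y − z with y, z in τ, then x + z lies in τ, and the face property applies to this sum. -/
theorem IsFaceOf.mem_of_mem_coneSpan {σ τ : PointedCone ℝ E} (hτ : τ.IsFaceOf σ) {x : E}
    (hx : x ∈ σ) (hx' : x ∈ coneSpan τ) : x ∈ τ := by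
  obtain ⟨y, hy, z, hz, rfl⟩ := mem_coneSpan_iff.1 hx'
  exact hτ.mem_of_add_mem_left hx (hτ.le hz) (by simpa using hy)

theorem IsFaceOf.finrank_lt {σ τ : PointedCone ℝ E} (hτ : τ.IsFaceOf σ) {x : E}
    (hx : x ∈ σ) (hx' : x ∉ τ) :
    Module.finrank ℝ (coneSpan τ) < Module.finrank ℝ (coneSpan σ) := by
  refine Submodule.finrank_lt_finrank_of_lt (lt_of_le_not_ge (coneSpan_mono hτ.le) fun h => ?_)
  exact hx' (hτ.mem_of_mem_coneSpan hx (h (mem_coneSpan hx)))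

theorem IsFaceOf.eq_of_finrank_le {σ τ : PointedCone ℝ E} (hτ : τ.IsFaceOf σ)
    (h : Module.finrank ℝ (coneSpan σ) ≤ Module.finrank ℝ (coneSpan τ)) : τ = σ := by
  refine le_antisymm hτ.le fun x hx => ?_
  by_contra hx'
  exact absurd (hτ.finrank_lt hx hx') (not_lt.2 h)

theorem IsFaceOf.of_le {σ τ ρ : PointedCone ℝ E} (hρ : ρ.IsFaceOf σ) (hτ : τ.IsFaceOf σ)
    (h : ρ ≤ τ) : ρ.IsFaceOf τ := (isFaceOf_iff_le hρ hτ).2 h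

theorem vanish_coneSpan {τ : PointedCone ℝ E} {f : E →ₗ[ℝ] ℝ} (h : ∀ x ∈ τ, f x = 0) {x : E}
    (hx : x ∈ coneSpan τ) : f x = 0 := by
  have : coneSpan τ ≤ LinearMap.ker f := Submodule.span_le.2 h
  exact this hx

/-- The part of a cone on which a linear form vanishes. -/
def zeroLocus (σ : PointedCone ℝ E) (f : E →ₗ[ℝ] ℝ) : PointedCone ℝ E :=
  σ ⊓ (LinearMap.ker f).restrictScalars _

theorem mem_zeroLocus {σ : PointedCone ℝ E} {f : E →ₗ[ℝ] ℝ} {x : E} :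
    x ∈ zeroLocus σ f ↔ x ∈ σ ∧ f x = 0 := Iff.rfl

theorem zeroLocus_isFaceOf {σ : PointedCone ℝ E} {f : E →ₗ[ℝ] ℝ} (hf : ∀ x ∈ σ, 0 ≤ f x) :
    (zeroLocus σ f).IsFaceOf σ := by
  refine IsFaceOf.of_mem_of_add_mem_left inf_le_left fun {x y} hx hy hxy => ⟨hx, ?_⟩
  have := (mem_zeroLocus.1 hxy).2
  rw [map_add] at this
  have h1 := hf x hx
  have h2 := hf y hy
  change f x = 0
  linarith

/-- A linear form that is nonnegative on generators is nonnegative on the cone. -/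
theorem nonneg_of_hull {s : Set E} {f : E →ₗ[ℝ] ℝ} (h : ∀ a ∈ s, 0 ≤ f a) {x : E}
    (hx : x ∈ PointedCone.hull ℝ s) : 0 ≤ f x := by
  induction hx using Submodule.span_induction with
  | mem x hx => exact h x hx
  | zero => simp
  | add x y _ _ hx hy => rw [map_add]; exact add_nonneg hx hy
  | smul c x _ hx =>
    have : f (c • x) = (c : ℝ) * f x := by
      exact f.map_smul (c : ℝ) x
    rw [this]
    exact mul_nonneg c.2 hx

theorem pos_of_hull {s : Set E} {σ ρ : PointedCone ℝ E} (hσ : σ = PointedCone.hull ℝ s)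
    (f : E →ₗ[ℝ] ℝ) (h0 : ∀ a ∈ ρ, f a = 0) (h : ∀ a ∈ s, a ∉ ρ → 0 < f a) {x : E}
    (hx : x ∈ σ) (hxρ : x ∉ ρ) : 0 < f x := by
  have key : ∀ x ∈ σ, 0 ≤ f x ∧ (x ∉ ρ → 0 < f x) := by
    intro x hx
    rw [hσ] at hx
    induction hx using Submodule.span_induction with
    | mem x hx =>
      refine ⟨?_, h x hx⟩
      by_cases hxρ : x ∈ ρ
      · exact (h0 x hxρ).ge
      · exact (h x hx hxρ).le
    | zero => exact ⟨by simp, fun h => absurd (zero_mem _) h⟩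
    | add x y _ _ hx hy =>
      rw [map_add]
      refine ⟨add_nonneg hx.1 hy.1, fun hxy => ?_⟩
      by_cases h1 : x ∈ ρ
      · by_cases h2 : y ∈ ρ
        · exact absurd (add_mem h1 h2) hxy
        · exact add_pos_of_nonneg_of_pos hx.1 (hy.2 h2)
      · exact add_pos_of_pos_of_nonneg (hx.2 h1) hy.1
    | smul c x _ hx =>
      have : f (c • x) = (c : ℝ) * f x := by
        exact f.map_smul (c : ℝ) x
      rw [this]
      refine ⟨mul_nonneg c.2 hx.1, fun hxc => ?_⟩
      rcases c.2.eq_or_lt with h0 | h0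
      · have : c = 0 := Subtype.ext h0.symm
        rw [this, zero_smul] at hxc
        exact absurd (zero_mem _) hxc
      · exact mul_pos h0 (hx.2 fun hh => hxc (Submodule.smul_mem _ _ hh))
  exact (key x hx).2 hxρ

/-- Faces of finitely generated cones are exposed. -/
theorem IsFaceOf.exists_exposing {σ ρ : PointedCone ℝ E} (hσ : σ.FG) (hρ : ρ.IsFaceOf σ) :
    ∃ h : E →ₗ[ℝ] ℝ, (∀ x ∈ ρ, h x = 0) ∧ ∀ x ∈ σ, x ∉ ρ → 0 < h x := by
  obtain ⟨s, hs⟩ := hσ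
  have hsσ : ∀ a ∈ s, a ∈ σ := fun a ha => hs ▸ Submodule.subset_span ha
  let A : Set E := {a ∈ (s : Set E) | a ∉ ρ}
  have hA : A.Finite := s.finite_toSet.subset (Set.sep_subset _ _)
  have hAσ : convexHull ℝ A ⊆ {x | x ∈ σ ∧ x ∉ ρ} := by
    refine convexHull_min (fun a ha => ⟨hsσ a ha.1, ha.2⟩) ?_
    rintro x ⟨hx, hx'⟩ y ⟨hy, hy'⟩ a b ha hb hab
    refine ⟨add_mem (smul_mem _ ha hx) (smul_mem _ hb hy), fun h => ?_⟩
    rcases ha.eq_or_lt with rfl | ha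
    · obtain rfl : b = 1 := by simpa using hab
      simp at h
      exact hy' h
    · exact hx' (hρ.mem_of_smul_add_mem hx (smul_mem _ hb hy) ha h)
  have hdisj : Disjoint (convexHull ℝ A) (coneSpan ρ : Set E) := by
    rw [Set.disjoint_left]
    intro x hx hx'
    exact (hAσ hx).2 (hρ.mem_of_mem_coneSpan (hAσ hx).1 hx')
  -- The form is bounded below on a subspace, hence vanishes there; the generators outside ρ lie
  -- strictly on its negative side.
  obtain ⟨f, u, v, hu, huv, hv⟩ := geometric_hahn_banach_compact_closed (convex_convexHull ℝ A)
    (hA.isCompact_convexHull ℝ) (coneSpan ρ).convex (coneSpan ρ).closed_of_finiteDimensional hdisj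
  have hv0 : v < 0 := by simpa using hv 0 (zero_mem _)
  have hzero : ∀ x ∈ coneSpan ρ, f x = 0 := by
    intro x hx
    by_contra hne
    have := hv ((v / f x) • x) (Submodule.smul_mem _ _ hx)
    rw [map_smul, smul_eq_mul, div_mul_cancel₀ _ hne] at this
    exact lt_irrefl _ this
  refine ⟨-(f : E →ₗ[ℝ] ℝ), fun x hx => by simp [hzero x (mem_coneSpan hx)], fun x hx hx' => ?_⟩
  refine pos_of_hull hs.symm _ (fun x hx => by simp [hzero x (mem_coneSpan hx)]) ?_ hx hx'
  intro a ha ha'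
  have := hu a (subset_convexHull ℝ _ ⟨ha, ha'⟩)
  simp only [LinearMap.neg_apply, ContinuousLinearMap.coe_coe]
  linarith

/-- The ratio of two linear forms attains its minimum on a finitely generated cone. -/
theorem exists_min_ratio {σ ρ : PointedCone ℝ E} (hσ : σ.FG) {f h : E →ₗ[ℝ] ℝ}
    (hf : ∀ x ∈ ρ, f x = 0) (hh : ∀ x ∈ ρ, h x = 0) (hpos : ∀ x ∈ σ, x ∉ ρ → 0 < h x)
    (hne : ∃ x ∈ σ, x ∉ ρ) :
    ∃ t : ℝ, (∀ x ∈ σ, t * h x ≤ f x) ∧ ∃ x ∈ σ, x ∉ ρ ∧ f x = t * h x := by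
  obtain ⟨s, hs⟩ := hσ
  have hsσ : ∀ a ∈ s, a ∈ σ := fun a ha => hs ▸ Submodule.subset_span ha
  have hne' : {a ∈ (s : Set E) | a ∉ ρ}.Nonempty := by
    by_contra hem
    rw [Set.not_nonempty_iff_eq_empty, Set.eq_empty_iff_forall_notMem] at hem
    obtain ⟨x, hx, hx'⟩ := hne
    rw [← hs] at hx
    refine hx' (Submodule.span_le.2 (fun a ha => ?_) hx)
    by_contra h
    exact hem a ⟨ha, h⟩
  -- Minimizing over the generators outside ρ suffices: f − t h is then nonnegative on every
  -- generator.
  obtain ⟨a, ha, hmin⟩ := Set.exists_min_image _ (fun a => f a / h a)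
    (s.finite_toSet.subset (Set.sep_subset _ _)) hne'
  have hha := hpos a (hsσ a ha.1) ha.2
  refine ⟨f a / h a, fun x hx => ?_, a, hsσ a ha.1, ha.2, by field_simp⟩
  rw [← hs] at hx
  have := nonneg_of_hull (f := f - (f a / h a) • h) (fun b hb => ?_) hx
  · simpa using this
  · simp only [LinearMap.sub_apply, LinearMap.smul_apply, smul_eq_mul, sub_nonneg]
    by_cases hbρ : b ∈ ρ
    · simp [hf b hbρ, hh b hbρ]
    · exact (le_div_iff₀ (hpos b (hsσ b hb) hbρ)).1 (hmin b ⟨hb, hbρ⟩)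

theorem exists_max_ratio {σ ρ : PointedCone ℝ E} (hσ : σ.FG) {f h : E →ₗ[ℝ] ℝ}
    (hf : ∀ x ∈ ρ, f x = 0) (hh : ∀ x ∈ ρ, h x = 0) (hpos : ∀ x ∈ σ, x ∉ ρ → 0 < h x)
    (hne : ∃ x ∈ σ, x ∉ ρ) :
    ∃ t : ℝ, (∀ x ∈ σ, f x ≤ t * h x) ∧ ∃ x ∈ σ, x ∉ ρ ∧ f x = t * h x := by
  obtain ⟨t, h1, x, hx, hx', h2⟩ := exists_min_ratio hσ (f := -f)
    (fun x hx => by simp [hf x hx]) hh hpos hne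
  refine ⟨-t, fun x hx => ?_, x, hx, hx', ?_⟩
  · have := h1 x hx
    simp at this
    linarith
  · simp at h2
    linarith

/-- If `ρ` has codimension at least two in `σ`, some linear form vanishing on `ρ` has a nonconstant ratio
with the form `h`. -/
theorem exists_nonconstant_ratio {σ ρ : PointedCone ℝ E} {h : E →ₗ[ℝ] ℝ} (hpos : ∀ x ∈ σ, x ∉ ρ → 0 < h x)
    (hdim : Module.finrank ℝ (coneSpan ρ) + 1 < Module.finrank ℝ (coneSpan σ)) :
    ∃ f : E →ₗ[ℝ] ℝ, (∀ x ∈ ρ, f x = 0) ∧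
      ∃ x ∈ σ, x ∉ ρ ∧ ∃ y ∈ σ, y ∉ ρ ∧ f x * h y ≠ f y * h x := by
  have hex : ∃ x ∈ σ, x ∉ ρ := by
    by_contra! hc
    have := Submodule.finrank_mono (coneSpan_mono (τ := σ) (σ := ρ) hc)
    omega
  obtain ⟨x, hx, hx'⟩ := hex
  -- Codimension two leaves room for such a y; a form killing ρ and x but not y has ratio 0 at x and
  -- a nonzero ratio at y.
  have hey : ∃ y ∈ σ, y ∉ coneSpan ρ ⊔ Submodule.span ℝ {x} := by
    by_contra! hc
    have h1 : Module.finrank ℝ (coneSpan σ) ≤ _ := Submodule.finrank_mono (Submodule.span_le.2 hc)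
    have h2 := Submodule.finrank_add_le_finrank_add_finrank (coneSpan ρ) (Submodule.span ℝ {x})
    have h3 : Module.finrank ℝ (Submodule.span ℝ {x}) ≤ 1 :=
      (finrank_span_le_card {x}).trans (by simp)
    omega
  obtain ⟨y, hy, hy'⟩ := hey
  obtain ⟨f, hfy, hf⟩ := Submodule.exists_le_ker_of_notMem hy'
  have hyρ : y ∉ ρ := fun h => hy' (Submodule.mem_sup_left (mem_coneSpan h))
  refine ⟨f, fun z hz => hf (Submodule.mem_sup_left (mem_coneSpan hz)), x, hx, hx', y, hy, hyρ, ?_⟩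
  have hfx : f x = 0 := hf (Submodule.mem_sup_right (Submodule.mem_span_singleton_self x))
  rw [hfx, zero_mul]
  exact (mul_ne_zero hfy (hpos x hx hx').ne').symm

end PointedCone

end

/-! ### Collapsing the faces on which a form is positive -/

noncomputable section

namespace PointedCone

variable {d : ℕ}

/-- The faces of `σ` that contain `ρ` and on which `f` is positive away from `ρ`. -/
def positiveFaces (σ ρ : PointedCone ℝ (Fin d → ℝ)) (f : (Fin d → ℝ) →ₗ[ℝ] ℝ) :
    Set (PointedCone ℝ (Fin d → ℝ)) :=
  {τ | τ.IsFaceOf σ ∧ ρ ≤ τ ∧ ∀ x ∈ τ, x ∉ ρ → 0 < f x}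

/-- The dimension of a cone. -/
abbrev dim (τ : PointedCone ℝ (Fin d → ℝ)) : ℕ := Module.finrank ℝ (coneSpan τ)

theorem positiveFaces_finite {σ ρ : PointedCone ℝ (Fin d → ℝ)} {f : (Fin d → ℝ) →ₗ[ℝ] ℝ}
    (hσ : σ.FG) : (positiveFaces σ ρ f).Finite :=
  (finite_faces hσ).subset fun _ h => h.1

variable {β : Type*} [Bot β] {V : PointedCone ℝ (Fin d → ℝ) → β} {v : β}

/-- The faces `τ ≠ ρ` on which the minimum `t` of `f / h` is not the maximum over `σ`. -/
theorem collapsible_of_min_ratio {σ ρ : PointedCone ℝ (Fin d → ℝ)} {f h : (Fin d → ℝ) →ₗ[ℝ] ℝ}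
    (hσ : σ.FG) (hf : ∀ x ∈ ρ, f x = 0) (hh : ∀ x ∈ ρ, h x = 0)
    (hpos : ∀ x ∈ σ, x ∉ ρ → 0 < h x)
    (hV : ∀ τ ∈ positiveFaces σ ρ f, V τ = v)
    (ih : ∀ (μ : PointedCone ℝ (Fin d → ℝ)) (g : (Fin d → ℝ) →ₗ[ℝ] ℝ),
      μ.IsFaceOf σ → dim ρ < dim μ → (∀ x ∈ μ, g x = 0) → (∃ x ∈ σ, 0 < g x) →
      (∀ τ ∈ positiveFaces σ μ g, V τ = v) → Collapsible dim V (positiveFaces σ μ g))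
    (hρ : ρ.IsFaceOf σ) {t : ℝ} (ht : ∃ x ∈ σ, t * h x < f x) :
    Collapsible dim V {τ ∈ positiveFaces σ ρ f |
      (∀ x ∈ τ, t * h x ≤ f x) ∧ ∃ x ∈ τ, x ∉ ρ ∧ f x = t * h x} := by
  have hg : ∀ x, (f - t • h) x = f x - t * h x := fun x => by simp
  -- The faces are sorted by the face μ on which the minimum t is attained. The fibre is
  -- `positiveFaces σ μ (f - t • h)`, and μ is strictly larger than ρ.
  refine Collapsible.of_fibers (fun τ => zeroLocus τ (f - t • h))
    ((positiveFaces_finite hσ).subset (Set.sep_subset _ _)) ?_ ?_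
  · intro τ _ τ' _ h
    exact inf_le_inf_right _ h
  · rintro τ ⟨hτ, hτt, x, hx, hxρ, hxt⟩
    set μ := zeroLocus τ (f - t • h) with hμ
    have hμτ : μ.IsFaceOf τ := zeroLocus_isFaceOf fun y hy => by
      rw [hg]
      linarith [hτt y hy]
    have hμσ : μ.IsFaceOf σ := hμτ.trans hτ.1
    have hxμ : x ∈ μ := ⟨hx, by change (f - t • h) x = 0; rw [hg, hxt, sub_self]⟩
    have hρμ : ρ ≤ μ := fun y hy => ⟨hτ.2.1 hy, by
      change (f - t • h) y = 0; rw [hg, hf y hy, hh y hy, mul_zero, sub_zero]⟩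
    have hμ0 : ∀ y ∈ μ, (f - t • h) y = 0 := fun y hy => hy.2
    -- Positivity of t lets f ≥ t h imply f > 0 off ρ.
    have htpos : 0 < t := by
      have h1 := hτ.2.2 x hx hxρ
      rw [hxt] at h1
      exact pos_of_mul_pos_left h1 (hpos x (hτ.1.le hx) hxρ).le
    have heq : {τ' ∈ {τ ∈ positiveFaces σ ρ f |
        (∀ x ∈ τ, t * h x ≤ f x) ∧ ∃ x ∈ τ, x ∉ ρ ∧ f x = t * h x} |
        zeroLocus τ' (f - t • h) = μ} = positiveFaces σ μ (f - t • h) := by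
      ext τ'
      constructor
      · rintro ⟨⟨hτ', hτ't, -⟩, hτ'μ⟩
        refine ⟨hτ'.1, hτ'μ ▸ inf_le_left, fun y hy hyμ => ?_⟩
        refine lt_of_le_of_ne ?_ fun h0 => hyμ ?_
        · rw [hg]
          linarith [hτ't y hy]
        · rw [← hτ'μ]
          exact ⟨hy, h0.symm⟩
      · rintro ⟨hτ', hμτ', hτ't⟩
        have hge : ∀ y ∈ τ', t * h y ≤ f y := by
          intro y hy
          by_cases hyμ : y ∈ μ
          · have := hμ0 y hyμ
            rw [hg] at this
            linarith
          · have := hτ't y hy hyμ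
            rw [hg] at this
            linarith
        refine ⟨⟨⟨hτ', hρμ.trans hμτ', fun y hy hyρ => ?_⟩, hge, x, hμτ' hxμ, hxρ, hxt⟩, ?_⟩
        · exact lt_of_lt_of_le (mul_pos htpos (hpos y (hτ'.le hy) hyρ)) (hge y hy)
        · refine le_antisymm (fun y hy => ?_) fun y hy => ⟨hμτ' hy, hμ0 y hy⟩
          by_contra hyμ
          exact (hτ't y hy.1 hyμ).ne' hy.2
    rw [heq]
    refine ih μ _ hμσ ((hρ.of_le hμσ hρμ).finrank_lt hxμ hxρ) hμ0 ?_ ?_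
    · obtain ⟨y, hy, hyt⟩ := ht
      exact ⟨y, hy, by rw [hg]; linarith⟩
    · intro τ' hτ'
      rw [← heq] at hτ'
      exact hV τ' hτ'.1.1

/-- The faces are sorted by the minimum of f/h. The top value T is attained exactly by faces inside
{f = T h}, which is a proper face because the ratio is not constant; the other values fall under
`collapsible_of_min_ratio`. -/
theorem collapsible_of_nonconstant_ratio {σ ρ : PointedCone ℝ (Fin d → ℝ)}
    {f h : (Fin d → ℝ) →ₗ[ℝ] ℝ}
    (hσ : σ.FG) (hf : ∀ x ∈ ρ, f x = 0) (hh : ∀ x ∈ ρ, h x = 0)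
    (hpos : ∀ x ∈ σ, x ∉ ρ → 0 < h x) (hfpos : ∃ x ∈ σ, 0 < f x)
    (hV : ∀ τ ∈ positiveFaces σ ρ f, V τ = v)
    (ih : ∀ (σ' μ : PointedCone ℝ (Fin d → ℝ)) (g : (Fin d → ℝ) →ₗ[ℝ] ℝ), σ'.FG →
      μ.IsFaceOf σ' → dim σ' + dim ρ < dim σ + dim μ → (∀ x ∈ μ, g x = 0) →
      (∃ x ∈ σ', 0 < g x) →
      (∀ τ ∈ positiveFaces σ' μ g, V τ = v) → Collapsible dim V (positiveFaces σ' μ g))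
    (hρ : ρ.IsFaceOf σ)
    (hnc : ∃ x ∈ σ, x ∉ ρ ∧ ∃ y ∈ σ, y ∉ ρ ∧ f x * h y ≠ f y * h x) :
    Collapsible dim V (positiveFaces σ ρ f) := by
  classical
  obtain ⟨x₀, hx₀, hx₀ρ, y₀, hy₀, hy₀ρ, hxy⟩ := hnc
  obtain ⟨T, hT, z, hz, hzρ, hzT⟩ := exists_max_ratio hσ hf hh hpos ⟨x₀, hx₀, hx₀ρ⟩
  have hmin : ∀ τ : PointedCone ℝ (Fin d → ℝ), ∃ t : ℝ, τ ∈ positiveFaces σ ρ f → τ ≠ ρ →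
      (∀ x ∈ τ, t * h x ≤ f x) ∧ ∃ x ∈ τ, x ∉ ρ ∧ f x = t * h x := by
    intro τ
    by_cases hτ : τ ∈ positiveFaces σ ρ f ∧ τ ≠ ρ
    · have : ∃ x ∈ τ, x ∉ ρ := by
        by_contra! hc
        exact hτ.2 (le_antisymm hc hτ.1.2.1)
      obtain ⟨t, ht⟩ := exists_min_ratio (hτ.1.1.fg hσ) hf hh
        (fun x hx => hpos x (hτ.1.1.le hx)) this
      exact ⟨t, fun _ _ => ht⟩
    · exact ⟨0, fun h1 h2 => absurd ⟨h1, h2⟩ hτ⟩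
  choose t ht using hmin
  have htT : ∀ τ ∈ positiveFaces σ ρ f, τ ≠ ρ → t τ ≤ T := by
    intro τ hτ hτρ
    obtain ⟨-, x, hx, hxρ, hxt⟩ := ht τ hτ hτρ
    have h1 := hT x (hτ.1.le hx)
    rw [hxt] at h1
    exact le_of_mul_le_mul_right h1 (hpos x (hτ.1.le hx) hxρ)
  have htu : ∀ τ ∈ positiveFaces σ ρ f, τ ≠ ρ → ∀ s, (∃ x ∈ τ, x ∉ ρ ∧ f x = s * h x) →
      t τ ≤ s := by
    rintro τ hτ hτρ s ⟨x, hx, hxρ, hxs⟩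
    have h1 := (ht τ hτ hτρ).1 x hx
    rw [hxs] at h1
    exact le_of_mul_le_mul_right h1 (hpos x (hτ.1.le hx) hxρ)
  have hTpos : 0 < T := by
    obtain ⟨x, hx, hfx⟩ := hfpos
    have hxρ : x ∉ ρ := fun h => hfx.ne' (hf x h)
    exact pos_of_mul_pos_left (hfx.trans_le (hT x hx)) (hpos x hx hxρ).le
  -- The sign makes the map monotone, since enlarging a face lowers the minimum. The face ρ has no
  -- minimum; giving it T puts it with the faces inside {f = T h}.
  refine Collapsible.of_fibers (fun τ => if τ = ρ then -T else -t τ) (positiveFaces_finite hσ) ?_ ?_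
  · intro τ hτ τ' hτ' hle
    by_cases h1 : τ = ρ
    · by_cases h2 : τ' = ρ
      · simp [h1, h2]
      · simp [h1, h2, htT τ' hτ' h2]
    · have h2 : τ' ≠ ρ := fun h => h1 (le_antisymm (h ▸ hle) hτ.2.1)
      obtain ⟨-, x, hx, hxρ, hxt⟩ := ht τ hτ h1
      simpa [h1, h2] using htu τ' hτ' h2 (t τ) ⟨x, hle hx, hxρ, hxt⟩
  · intro τ hτ
    by_cases hτT : τ = ρ ∨ t τ = T
    · have hval : (if τ = ρ then -T else -t τ) = -T := by
        rcases hτT with h | h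
        · simp [h]
        · simp [h]
      let g : (Fin d → ℝ) →ₗ[ℝ] ℝ := T • h - f
      have hg : ∀ x, g x = T * h x - f x := fun x => by simp [g]
      have hσT : (zeroLocus σ g).IsFaceOf σ := zeroLocus_isFaceOf fun x hx => by
        rw [hg]
        linarith [hT x hx]
      have hmem : ∀ x, x ∈ zeroLocus σ g ↔ x ∈ σ ∧ f x = T * h x := by
        intro x
        rw [mem_zeroLocus, hg, sub_eq_zero, eq_comm (a := T * h x)]
      have hρT : ρ ≤ zeroLocus σ g := fun x hx =>
        (hmem x).2 ⟨hρ.le hx, by rw [hf x hx, hh x hx, mul_zero]⟩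
      have heq : {τ' ∈ positiveFaces σ ρ f |
          (if τ' = ρ then -T else -t τ') = (if τ = ρ then -T else -t τ)} =
          positiveFaces (zeroLocus σ g) ρ f := by
        rw [hval]
        ext τ'
        constructor
        · rintro ⟨hτ', h2⟩
          refine ⟨hτ'.1.of_le hσT ?_, hτ'.2⟩
          by_cases h1 : τ' = ρ
          · exact h1 ▸ hρT
          · simp only [h1, if_false, neg_inj] at h2
            intro x hx
            refine (hmem x).2 ⟨hτ'.1.le hx, le_antisymm (hT x (hτ'.1.le hx)) ?_⟩
            rw [← h2]
            exact (ht τ' hτ' h1).1 x hx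
        · intro hτ'
          have hX : τ' ∈ positiveFaces σ ρ f := ⟨hτ'.1.trans hσT, hτ'.2⟩
          refine ⟨hX, ?_⟩
          by_cases h1 : τ' = ρ
          · simp [h1]
          · simp only [h1, if_false, neg_inj]
            obtain ⟨-, x, hx, hxρ, hxt⟩ := ht τ' hX h1
            have hx' := (hmem x).1 (hτ'.1.le hx)
            rw [hxt] at hx'
            exact mul_right_cancel₀ (hpos x hx'.1 hxρ).ne' hx'.2
      rw [heq]
      have hlt : dim (zeroLocus σ g) < dim σ := by
        by_cases hx : x₀ ∈ zeroLocus σ g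
        · by_cases hy : y₀ ∈ zeroLocus σ g
          · refine absurd ?_ hxy
            rw [((hmem _).1 hx).2, ((hmem _).1 hy).2]
            ring
          · exact hσT.finrank_lt hy₀ hy
        · exact hσT.finrank_lt hx₀ hx
      refine ih _ ρ f (hσT.fg hσ) (hρ.of_le hσT hρT) (by omega) hf ?_ ?_
      · exact ⟨z, (hmem z).2 ⟨hz, hzT⟩, hzT ▸ mul_pos hTpos (hpos z hz hzρ)⟩
      · exact fun τ' hτ' => hV τ' ⟨hτ'.1.trans hσT, hτ'.2⟩
    · push Not at hτT
      have hlt : t τ < T := lt_of_le_of_ne (htT τ hτ hτT.1) hτT.2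
      have heq : {τ' ∈ positiveFaces σ ρ f |
          (if τ' = ρ then -T else -t τ') = (if τ = ρ then -T else -t τ)} =
          {τ' ∈ positiveFaces σ ρ f |
            (∀ x ∈ τ', t τ * h x ≤ f x) ∧ ∃ x ∈ τ', x ∉ ρ ∧ f x = t τ * h x} := by
        rw [if_neg hτT.1]
        ext τ'
        refine and_congr_right fun hτ' => ?_
        by_cases h1 : τ' = ρ
        · simp only [h1, if_true, neg_inj]
          constructor
          · intro h2
            exact absurd h2 hlt.ne'
          · rintro ⟨-, x, hx, hxρ, -⟩
            exact absurd hx hxρ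
        · simp only [h1, if_false, neg_inj]
          constructor
          · intro h2
            rw [← h2]
            exact ht τ' hτ' h1
          · rintro ⟨h2, h3⟩
            refine le_antisymm (htu τ' hτ' h1 _ h3) ?_
            obtain ⟨-, x, hx, hxρ, hxt⟩ := ht τ' hτ' h1
            have h4 := h2 x hx
            rw [hxt] at h4
            exact le_of_mul_le_mul_right h4 (hpos x (hτ'.1.le hx) hxρ)
      rw [heq]
      -- As t < T, the form f − t h is still positive at the point z where T is attained.
      refine collapsible_of_min_ratio hσ hf hh hpos hV ?_ hρ ?_
      · intro μ g' h1 h2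
        exact ih σ μ g' hσ h1 (by omega)
      · exact ⟨z, hz, by rw [hzT]; exact mul_lt_mul_of_pos_right hlt (hpos z hz hzρ)⟩

/-- The faces of a cone `σ` on which `f` is positive away from a face `ρ` are collapsible as soon as `f` is
positive somewhere on `σ`. -/
theorem collapsible_positiveFaces {σ ρ : PointedCone ℝ (Fin d → ℝ)} {f : (Fin d → ℝ) →ₗ[ℝ] ℝ}
    (hσ : σ.FG) (hρ : ρ.IsFaceOf σ) (hf : ∀ x ∈ ρ, f x = 0) (hfpos : ∃ x ∈ σ, 0 < f x)
    (hV : ∀ τ ∈ positiveFaces σ ρ f, V τ = v) : Collapsible dim V (positiveFaces σ ρ f) := by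
  obtain ⟨N, hN⟩ : ∃ N, dim σ ≤ dim ρ + N := ⟨_, Nat.le_add_left _ _⟩
  induction N generalizing σ ρ f with
  | zero =>
    -- Here ρ = σ, so f vanishes on all of σ, against its positivity somewhere.
    obtain rfl := hρ.eq_of_finrank_le hN
    obtain ⟨x, hx, hfx⟩ := hfpos
    exact absurd (hf x hx) hfx.ne'
  | succ N ih =>
    obtain ⟨h, hh, hpos⟩ := hρ.exists_exposing hσ
    have ih' : ∀ (σ' μ : PointedCone ℝ (Fin d → ℝ)) (g : (Fin d → ℝ) →ₗ[ℝ] ℝ), σ'.FG →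
        μ.IsFaceOf σ' → dim σ' + dim ρ < dim σ + dim μ → (∀ x ∈ μ, g x = 0) →
        (∃ x ∈ σ', 0 < g x) → (∀ τ ∈ positiveFaces σ' μ g, V τ = v) →
        Collapsible dim V (positiveFaces σ' μ g) :=
      fun σ' μ g h1 h2 h3 h4 h5 h6 => ih h1 h2 h4 h5 h6 (by omega)
    by_cases hnc : ∃ x ∈ σ, x ∉ ρ ∧ ∃ y ∈ σ, y ∉ ρ ∧ f x * h y ≠ f y * h x
    · exact collapsible_of_nonconstant_ratio hσ hf hh hpos hfpos hV ih' hρ hnc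
    · push Not at hnc
      obtain ⟨x, hx, hfx⟩ := hfpos
      have hxρ : x ∉ ρ := fun h => hfx.ne' (hf x h)
      -- A constant ratio that is positive once is positive everywhere off ρ, so the set in question
      -- is the whole interval from ρ to σ.
      have hall : ∀ y ∈ σ, y ∉ ρ → 0 < f y := by
        intro y hy hyρ
        have h1 := hnc x hx hxρ y hy hyρ
        have h2 := mul_pos hfx (hpos y hy hyρ)
        rw [h1] at h2
        exact pos_of_mul_pos_left h2 (hpos x hx hxρ).le
      have hX : ∀ g : (Fin d → ℝ) →ₗ[ℝ] ℝ, (∀ y ∈ σ, y ∉ ρ → 0 < g y) →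
          positiveFaces σ ρ g = {τ | τ.IsFaceOf σ ∧ ρ ≤ τ} := by
        intro g hg
        ext τ
        exact ⟨fun h => ⟨h.1, h.2.1⟩, fun h => ⟨h.1, h.2, fun y hy => hg y (h.1.le hy)⟩⟩
      have hlt := hρ.finrank_lt hx hxρ
      -- In codimension one the interval is the pair {ρ, σ}. In higher codimension f may be replaced
      -- by any form positive off ρ, and one with nonconstant ratio exists.
      rcases (Nat.succ_le_of_lt hlt).eq_or_lt with heq | hlt'
      · rw [hX f hall] at hV ⊢
        convert Collapsible.pair (rk := dim) (V := V) ρ σ hρ.le heq.symm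
          ((hV ρ ⟨hρ, le_rfl⟩).trans (hV σ ⟨.refl σ, hρ.le⟩).symm) using 1
        ext τ
        constructor
        · rintro ⟨h1, h2⟩
          have h3 := Submodule.finrank_mono (coneSpan_mono h2)
          by_cases h4 : dim τ ≤ dim ρ
          · exact Or.inl ((hρ.of_le h1 h2).eq_of_finrank_le h4).symm
          · exact Or.inr (h1.eq_of_finrank_le (by
              simp only [dim] at h4
              omega))
        · rintro (rfl | rfl)
          · exact ⟨hρ, le_rfl⟩
          · exact ⟨.refl _, hρ.le⟩
      · obtain ⟨f₂, hf₂, x₁, hx₁, hx₁ρ, y₁, hy₁, hy₁ρ, hne⟩ :=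
          exists_nonconstant_ratio hpos hlt'
        obtain ⟨t, ht, -⟩ := exists_min_ratio hσ hf₂ hh hpos ⟨x, hx, hxρ⟩
        -- The multiple of h shifts the minimal ratio from t to 1, keeping the ratio nonconstant.
        let g : (Fin d → ℝ) →ₗ[ℝ] ℝ := f₂ + (1 - t) • h
        have hg : ∀ y, g y = f₂ y + (1 - t) * h y := fun y => by simp [g]
        have hgpos : ∀ y ∈ σ, y ∉ ρ → 0 < g y := by
          intro y hy hyρ
          rw [hg]
          linarith [ht y hy, hpos y hy hyρ]
        have hXg : positiveFaces σ ρ f = positiveFaces σ ρ g := by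
          rw [hX f hall, hX g hgpos]
        rw [hXg] at hV ⊢
        refine collapsible_of_nonconstant_ratio hσ ?_ hh hpos ⟨x, hx, hgpos x hx hxρ⟩ hV ih' hρ
          ⟨x₁, hx₁, hx₁ρ, y₁, hy₁, hy₁ρ, fun h1 => hne ?_⟩
        · intro y hy
          rw [hg, hf₂ y hy, hh y hy]
          simp
        · rw [hg, hg] at h1
          linarith

end PointedCone

end

/-! ### The diamond property -/

noncomputable section

namespace PointedCone

variable {d : ℕ}

theorem coneSpan_eq_sup {σ ρ : PointedCone ℝ (Fin d → ℝ)} (h : ρ ≤ σ)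
    (hdim : dim σ = dim ρ + 1) {x : Fin d → ℝ} (hx : x ∈ coneSpan σ) (hx' : x ∉ coneSpan ρ) :
    coneSpan σ = coneSpan ρ ⊔ Submodule.span ℝ {x} := by
  symm
  refine Submodule.eq_of_le_of_finrank_le (sup_le (coneSpan_mono h) ?_) ?_
  · rwa [Submodule.span_singleton_le_iff_mem]
  · have : Module.finrank ℝ (coneSpan ρ) <
        Module.finrank ℝ (coneSpan ρ ⊔ Submodule.span ℝ {x} : Submodule ℝ (Fin d → ℝ)) := by
      refine Submodule.finrank_lt_finrank_of_lt (lt_of_le_not_ge le_sup_left fun hle => ?_)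
      exact hx' (hle (Submodule.mem_sup_right (Submodule.mem_span_singleton_self x)))
    simp only [dim] at hdim
    omega

/-- The diamond property of the face lattice of a cone. -/
theorem IsFaceOf.exists_two_between {σ ρ : PointedCone ℝ (Fin d → ℝ)} (hσ : σ.FG)
    (hρ : ρ.IsFaceOf σ) (hdim : dim σ = dim ρ + 2) :
    ∃ τ₁ τ₂ : PointedCone ℝ (Fin d → ℝ), τ₁ ≠ τ₂ ∧
      (τ₁.IsFaceOf σ ∧ ρ ≤ τ₁ ∧ dim τ₁ = dim ρ + 1) ∧
      (τ₂.IsFaceOf σ ∧ ρ ≤ τ₂ ∧ dim τ₂ = dim ρ + 1) ∧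
      ∀ τ : PointedCone ℝ (Fin d → ℝ), τ.IsFaceOf σ → ρ ≤ τ → dim τ = dim ρ + 1 →
        τ = τ₁ ∨ τ = τ₂ := by
  obtain ⟨h, hh, hpos⟩ := hρ.exists_exposing hσ
  obtain ⟨f, hf, x₀, hx₀, hx₀ρ, y₀, hy₀, hy₀ρ, hne⟩ := exists_nonconstant_ratio hpos
    (show dim ρ + 1 < dim σ by omega)
  -- The two intermediate faces are those where f/h attains its minimum s and its maximum t over σ.
  obtain ⟨s, hs, a, ha, haρ, has⟩ := exists_min_ratio hσ hf hh hpos ⟨x₀, hx₀, hx₀ρ⟩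
  obtain ⟨t, ht, b, hb, hbρ, hbt⟩ := exists_max_ratio hσ hf hh hpos ⟨x₀, hx₀, hx₀ρ⟩
  have hha := hpos a ha haρ
  have hhb := hpos b hb hbρ
  have hst : s < t := by
    by_contra! hc
    have key : ∀ x ∈ σ, x ∉ ρ → f x = s * h x := fun x hx hxρ =>
      le_antisymm ((ht x hx).trans (mul_le_mul_of_nonneg_right hc (hpos x hx hxρ).le)) (hs x hx)
    refine hne ?_
    rw [key x₀ hx₀ hx₀ρ, key y₀ hy₀ hy₀ρ]
    ring
  have hlin : ∀ (r : ℝ) x, (f - r • h) x = f x - r * h x := fun r x => by simp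
  have hlin' : ∀ (r : ℝ) x, (r • h - f) x = r * h x - f x := fun r x => by simp
  have h1σ : (zeroLocus σ (f - s • h)).IsFaceOf σ := zeroLocus_isFaceOf fun x hx => by
    rw [hlin]
    linarith [hs x hx]
  have h2σ : (zeroLocus σ (t • h - f)).IsFaceOf σ := zeroLocus_isFaceOf fun x hx => by
    rw [hlin']
    linarith [ht x hx]
  have h1 : ∀ x, x ∈ zeroLocus σ (f - s • h) ↔ x ∈ σ ∧ f x = s * h x := fun x => by
    rw [mem_zeroLocus, hlin, sub_eq_zero]
  have h2 : ∀ x, x ∈ zeroLocus σ (t • h - f) ↔ x ∈ σ ∧ f x = t * h x := fun x => by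
    rw [mem_zeroLocus, hlin', sub_eq_zero, eq_comm (a := t * h x)]
  have ha1 := (h1 a).2 ⟨ha, has⟩
  have hb2 := (h2 b).2 ⟨hb, hbt⟩
  have hb1 : b ∉ zeroLocus σ (f - s • h) := fun hc => by
    have := ((h1 b).1 hc).2
    rw [hbt] at this
    exact hst.ne' (mul_right_cancel₀ hhb.ne' this)
  have ha2 : a ∉ zeroLocus σ (t • h - f) := fun hc => by
    have := ((h2 a).1 hc).2
    rw [has] at this
    exact hst.ne (mul_right_cancel₀ hha.ne' this)
  have hρ1 : ρ ≤ zeroLocus σ (f - s • h) := fun x hx =>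
    (h1 x).2 ⟨hρ.le hx, by rw [hf x hx, hh x hx, mul_zero]⟩
  have hρ2 : ρ ≤ zeroLocus σ (t • h - f) := fun x hx =>
    (h2 x).2 ⟨hρ.le hx, by rw [hf x hx, hh x hx, mul_zero]⟩
  have hd1 : dim (zeroLocus σ (f - s • h)) = dim ρ + 1 := by
    have h3 : dim _ < dim _ := (hρ.of_le h1σ hρ1).finrank_lt ha1 haρ
    have h4 : dim _ < dim _ := h1σ.finrank_lt hb hb1
    omega
  have hd2 : dim (zeroLocus σ (t • h - f)) = dim ρ + 1 := by
    have h3 : dim _ < dim _ := (hρ.of_le h2σ hρ2).finrank_lt hb2 hbρ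
    have h4 : dim _ < dim _ := h2σ.finrank_lt ha ha2
    omega
  refine ⟨_, _, fun hc => ha2 (by rw [← hc]; exact ha1), ⟨h1σ, hρ1, hd1⟩, ⟨h2σ, hρ2, hd2⟩, fun τ hτ hρτ hdτ => ?_⟩
  obtain ⟨x, hx, hxρ⟩ : ∃ x ∈ τ, x ∉ ρ := by
    by_contra! hc
    have : dim τ ≤ dim ρ := Submodule.finrank_mono (coneSpan_mono hc)
    omega
  have hxσ := hτ.le hx
  have hhx := hpos x hxσ hxρ
  obtain ⟨r, hr⟩ : ∃ r, f x = r * h x := ⟨f x / h x, by field_simp⟩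
  have hτr : ∀ y ∈ τ, f y = r * h y := by
    intro y hy
    have hy' := mem_coneSpan hy
    rw [coneSpan_eq_sup hρτ hdτ (mem_coneSpan hx)
      (fun hc => hxρ (hρ.mem_of_mem_coneSpan hxσ hc))] at hy'
    have hle : coneSpan ρ ⊔ Submodule.span ℝ {x} ≤ LinearMap.ker (f - r • h) := by
      refine sup_le (Submodule.span_le.2 fun z hz => ?_) ?_
      · change (f - r • h) z = 0
        rw [hlin, hf z hz, hh z hz, mul_zero, sub_zero]
      · rw [Submodule.span_singleton_le_iff_mem]
        change (f - r • h) x = 0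
        rw [hlin, hr, sub_self]
    have := hle hy'
    change (f - r • h) y = 0 at this
    rw [hlin] at this
    linarith
  rcases (show s ≤ r from le_of_mul_le_mul_right (hr ▸ hs x hxσ) hhx).eq_or_lt with rfl | hsr
  · left
    have hle : τ ≤ zeroLocus σ (f - s • h) := fun y hy => (h1 y).2 ⟨hτ.le hy, hτr y hy⟩
    exact (hτ.of_le h1σ hle).eq_of_finrank_le (by simp only [dim] at *; omega)
  rcases (show r ≤ t from le_of_mul_le_mul_right (hr ▸ ht x hxσ) hhx).eq_or_lt with rfl | hrt
  · right
    have hle : τ ≤ zeroLocus σ (r • h - f) := fun y hy => (h2 y).2 ⟨hτ.le hy, hτr y hy⟩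
    exact (hτ.of_le h2σ hle).eq_of_finrank_le (by simp only [dim] at *; omega)
  -- An intermediate face with ratio s < r < t is impossible: modulo the span of ρ, x = αa + βb, and
  -- the ratios force α > 0 and β ≥ 0. The face property then puts a in τ, although its ratio is s.
  exfalso
  have hx' := mem_coneSpan hxσ
  rw [coneSpan_eq_sup h1σ.le (by omega) (mem_coneSpan hb)
    (fun hc => hb1 (h1σ.mem_of_mem_coneSpan hb hc)), coneSpan_eq_sup hρ1 hd1 (mem_coneSpan ha1)
    (fun hc => haρ (hρ.mem_of_mem_coneSpan ha hc))] at hx'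
  obtain ⟨u, hu, v, hv, huv⟩ := Submodule.mem_sup.1 hx'
  obtain ⟨u', hu', u'', hu'', rfl⟩ := Submodule.mem_sup.1 hu
  obtain ⟨α, rfl⟩ := Submodule.mem_span_singleton.1 hu''
  obtain ⟨β, rfl⟩ := Submodule.mem_span_singleton.1 hv
  have e1 : f x = α * (s * h a) + β * (t * h b) := by
    rw [← huv]
    simp [vanish_coneSpan hf hu', has, hbt]
  have e2 : h x = α * h a + β * h b := by
    rw [← huv]
    simp [vanish_coneSpan hh hu']
  obtain ⟨p, hp, q, hq, rfl⟩ := mem_coneSpan_iff.1 hu'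
  have e3 : (α * h a) * (r - s) = (β * h b) * (t - r) := by
    rw [hr, e2] at e1
    linarith
  have hα : 0 < α := by
    by_contra! hc
    have h5 : α * h a ≤ 0 := mul_nonpos_of_nonpos_of_nonneg hc hha.le
    have h6 : 0 < β * h b := by linarith
    have h7 := mul_pos h6 (sub_pos.2 hrt)
    have h8 := mul_nonpos_of_nonpos_of_nonneg h5 (sub_pos.2 hsr).le
    linarith
  have hβ : 0 ≤ β := by
    by_contra! hc
    have h5 := mul_pos (mul_pos hα hha) (sub_pos.2 hsr)
    have h6 := mul_neg_of_neg_of_pos (mul_neg_of_neg_of_pos hc hhb) (sub_pos.2 hrt)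
    linarith
  have haτ : a ∈ τ := by
    refine hτ.mem_of_smul_add_mem (y := p + β • b) ha
      (add_mem (hρ.le hp) (smul_mem _ hβ hb)) hα ?_
    have : α • a + (p + β • b) = x + q := by
      rw [← huv]
      abel
    rw [this]
    exact add_mem hx (hρτ hq)
  have := hτr a haτ
  rw [has] at this
  exact hsr.ne (mul_right_cancel₀ hha.ne' this)

end PointedCone

/-! ### Top forms and inherited orientations -/

section Forms

open Module

variable {F : Type*} [AddCommGroup F] [Module ℝ F]

theorem AlternatingMap.eq_smul_of_basis {k : ℕ} (b : Basis (Fin k) ℝ F) {ω : F [⋀^Fin k]→ₗ[ℝ] ℝ}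
    (hω : ω b ≠ 0) (η : F [⋀^Fin k]→ₗ[ℝ] ℝ) : η = (η b / ω b) • ω := by
  ext v
  have h1 := congrArg (fun ξ => ξ v) (η.eq_smul_basis_det b)
  have h2 := congrArg (fun ξ => ξ v) (ω.eq_smul_basis_det b)
  simp only [AlternatingMap.smul_apply, smul_eq_mul] at h1 h2 ⊢
  rw [h1, h2]
  field_simp

theorem AlternatingMap.apply_basis_ne_zero {k : ℕ} (b : Basis (Fin k) ℝ F)
    {ω : F [⋀^Fin k]→ₗ[ℝ] ℝ} (hω : ω ≠ 0) : ω b ≠ 0 := by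
  intro h
  refine hω ?_
  rw [ω.eq_smul_basis_det b, h, zero_smul]

/-- Two nonzero top forms lie on a common ray iff their values at a basis have the same sign. -/
theorem AlternatingMap.ray_eq_iff_basis {k : ℕ} (b : Basis (Fin k) ℝ F)
    {ω η : F [⋀^Fin k]→ₗ[ℝ] ℝ} (hω : ω ≠ 0) (hη : η ≠ 0) :
    rayOfNeZero ℝ ω hω = rayOfNeZero ℝ η hη ↔ 0 < ω b * η b := by
  rw [ray_eq_iff]
  have h1 := apply_basis_ne_zero b hω
  have h2 := apply_basis_ne_zero b hη
  constructor
  · intro h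
    obtain ⟨r₁, r₂, hr₁, hr₂, h⟩ := h.exists_pos hω hη
    have h3 := congrArg (fun ξ => ξ b) h
    simp only [AlternatingMap.smul_apply, smul_eq_mul] at h3
    have h4 : 0 < r₁ * (ω b * ω b) := mul_pos hr₁ (mul_self_pos.2 h1)
    have h5 : r₁ * (ω b * ω b) = r₂ * (ω b * η b) := by linear_combination (ω b) * h3
    rw [h5] at h4
    exact pos_of_mul_pos_right h4 hr₂.le
  · intro h
    rw [eq_smul_of_basis b h1 η]
    refine SameRay.sameRay_nonneg_smul_right _ ?_
    rw [div_eq_mul_inv]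
    rcases lt_or_gt_of_ne h1 with h3 | h3
    · exact mul_nonneg_of_nonpos_of_nonpos (by nlinarith) (inv_nonpos.2 h3.le)
    · exact mul_nonneg (by nlinarith) (inv_nonneg.2 h3.le)

end Forms

namespace PointedCone

open Module

variable {d k : ℕ}

/-- The vectors of the span of a subcone, seen in the span of the cone. -/
abbrev spanIncl {τ σ : PointedCone ℝ (Fin d → ℝ)} (h : τ ≤ σ) : coneSpan τ →ₗ[ℝ] coneSpan σ :=
  Submodule.inclusion (coneSpan_mono h)

/-- A basis of a facet is completed to a basis of the cone by any vector outside the facet. -/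
theorem exists_basis_cons {τ σ : PointedCone ℝ (Fin d → ℝ)} (h : τ ≤ σ)
    (b : Basis (Fin k) ℝ (coneSpan τ)) (hσ : dim σ = k + 1) {w : coneSpan σ}
    (hw : (w : Fin d → ℝ) ∉ coneSpan τ) :
    ∃ b' : Basis (Fin (k + 1)) ℝ (coneSpan σ), ⇑b' = Fin.cons w (spanIncl h ∘ b) := by
  have hli : LinearIndependent ℝ (Fin.cons w (spanIncl h ∘ b) : Fin (k + 1) → coneSpan σ) := by
    rw [linearIndependent_finCons]
    refine ⟨b.linearIndependent.map' _ (Submodule.ker_inclusion _ _ _), fun hc => hw ?_⟩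
    have hle : Submodule.span ℝ (Set.range (spanIncl h ∘ b)) ≤
        (coneSpan τ).comap (coneSpan σ).subtype := by
      refine Submodule.span_le.2 ?_
      rintro _ ⟨i, rfl⟩
      exact (b i).2
    exact hle hc
  exact ⟨basisOfLinearIndependentOfCardEqFinrank hli (by simpa using hσ.symm), by simp⟩

theorem cons_apply_ne_zero {τ σ : PointedCone ℝ (Fin d → ℝ)} (h : τ ≤ σ)
    (b : Basis (Fin k) ℝ (coneSpan τ)) (hσ : dim σ = k + 1)
    {ω : (coneSpan σ) [⋀^Fin (k + 1)]→ₗ[ℝ] ℝ} (hω : ω ≠ 0) {w : coneSpan σ}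
    (hw : (w : Fin d → ℝ) ∉ coneSpan τ) :
    ω (Fin.cons w (spanIncl h ∘ b)) ≠ 0 := by
  obtain ⟨b', hb'⟩ := exists_basis_cons h b hσ hw
  rw [← hb']
  exact AlternatingMap.apply_basis_ne_zero b' hω

/-- All k + 1 arguments lie in the k-dimensional span of τ. Hence changing a normal by a vector of
this span does not affect the value of the form. -/
theorem cons_apply_eq_zero {τ σ : PointedCone ℝ (Fin d → ℝ)} (h : τ ≤ σ)
    (b : Basis (Fin k) ℝ (coneSpan τ))
    (ω : (coneSpan σ) [⋀^Fin (k + 1)]→ₗ[ℝ] ℝ) (u : coneSpan τ) :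
    ω (Fin.cons (spanIncl h u) (spanIncl h ∘ b)) = 0 := by
  refine ω.map_linearDependent _ fun hli => ?_
  rw [linearIndependent_finCons] at hli
  refine hli.2 ?_
  rw [Set.range_comp, Submodule.span_image, b.span_eq]
  exact ⟨u, trivial, rfl⟩

/-- The inherited orientation can be tested with any inner normal and any basis. -/
theorem inducesOrientation_iff {τ σ : PointedCone ℝ (Fin d → ℝ)} (h : τ ≤ σ) (hτσ : τ.IsFaceOf σ)
    (b : Basis (Fin k) ℝ (coneSpan τ)) (hσ : dim σ = k + 1)
    {ωτ : (coneSpan τ) [⋀^Fin k]→ₗ[ℝ] ℝ} {ωσ : (coneSpan σ) [⋀^Fin (k + 1)]→ₗ[ℝ] ℝ}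
    (hωτ : ωτ ≠ 0) (hωσ : ωσ ≠ 0) {w : coneSpan σ} (hw : (w : Fin d → ℝ) ∈ σ)
    (hwτ : (w : Fin d → ℝ) ∉ coneSpan τ) :
    InducesOrientation h (rayOfNeZero ℝ ωτ hωτ) (rayOfNeZero ℝ ωσ hωσ) ↔
      0 < ωσ (Fin.cons (-w) (spanIncl h ∘ b)) * ωτ b := by
  have hτd : dim τ = k := by simpa using Module.finrank_eq_card_basis b
  have happ : ∀ (ω : (coneSpan σ) [⋀^Fin (k + 1)]→ₗ[ℝ] ℝ) (w : coneSpan σ),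
      ((ω.curryLeft (-w)).compLinearMap (Submodule.inclusion (Submodule.span_mono h))) b =
        ω (Fin.cons (-w) (spanIncl h ∘ b)) := fun _ _ => rfl
  have hneg : ∀ w : coneSpan σ, (w : Fin d → ℝ) ∉ coneSpan τ →
      ((-w : coneSpan σ) : Fin d → ℝ) ∉ coneSpan τ := fun w hw hc => hw (by simpa using hc)
  constructor
  · rintro ⟨w', ω, hω, hτ, hw', hw'τ, e1, e2⟩
    rw [AlternatingMap.ray_eq_iff_basis b, happ] at e2
    have hsup := coneSpan_eq_sup h (by omega) w.2 hwτ
    have hw'' : (w' : Fin d → ℝ) ∈ coneSpan τ ⊔ Submodule.span ℝ {(w : Fin d → ℝ)} :=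
      hsup.le w'.2
    obtain ⟨u, hu, v, hv, huv⟩ := Submodule.mem_sup.1 hw''
    obtain ⟨s, rfl⟩ := Submodule.mem_span_singleton.1 hv
    -- If s ≤ 0, then w' − s w = u would lie in σ and in the span of τ, hence in τ, and the face
    -- property would put w' in τ.
    have hs : 0 < s := by
      by_contra! hc
      refine hw'τ (mem_coneSpan (hτσ.mem_of_add_mem_left hw'
        (smul_mem σ (neg_nonneg.2 hc) hw) ?_))
      refine hτσ.mem_of_mem_coneSpan (add_mem hw' (smul_mem σ (neg_nonneg.2 hc) hw)) ?_
      rw [← huv]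
      convert hu using 1
      module
    have hw'eq : -w' = s • (-w) + spanIncl h (-⟨u, hu⟩) := by
      ext1
      simp only [Submodule.coe_neg, Submodule.coe_add, Submodule.coe_smul, Submodule.coe_inclusion,
        ← huv]
      module
    have hval : ∀ ω : (coneSpan σ) [⋀^Fin (k + 1)]→ₗ[ℝ] ℝ,
        ω (Fin.cons (-w') (spanIncl h ∘ b)) = s * ω (Fin.cons (-w) (spanIncl h ∘ b)) := by
      intro ω
      have e3 := (ω.curryLeft).map_add (s • (-w)) (spanIncl h (-⟨u, hu⟩))
      have e4 := congrArg (fun ξ => ξ (spanIncl h ∘ b)) e3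
      rw [← hw'eq, map_smul] at e4
      have e5 := cons_apply_eq_zero h b ω (-⟨u, hu⟩)
      simp only [AlternatingMap.add_apply, AlternatingMap.smul_apply, smul_eq_mul,
        AlternatingMap.curryLeft_apply_apply] at e4
      change ω (Fin.cons (-w') (spanIncl h ∘ b)) = s * ω (Fin.cons (-w) (spanIncl h ∘ b)) +
        ω (Fin.cons (spanIncl h (-⟨u, hu⟩)) (spanIncl h ∘ b)) at e4
      rw [e4, e5, add_zero]
    rw [hval] at e2
    rw [ray_eq_iff] at e1
    obtain ⟨r₁, r₂, hr₁, hr₂, e⟩ := e1.exists_pos hω hωσ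
    have e6 := congrArg (fun ξ => ξ (Fin.cons (-w) (spanIncl h ∘ b))) e
    simp only [AlternatingMap.smul_apply, smul_eq_mul] at e6
    have e7 : s * (r₂ * (ωσ (Fin.cons (-w) (spanIncl h ∘ b)) * ωτ b)) =
        r₁ * (s * ω (Fin.cons (-w) (spanIncl h ∘ b)) * ωτ b) := by
      linear_combination (-s * ωτ b) * e6
    have e8 := mul_pos hr₁ e2
    rw [← e7] at e8
    exact pos_of_mul_pos_right (pos_of_mul_pos_right e8 hs.le) hr₂.le
  · intro hpos
    have hne : (ωσ.curryLeft (-w)).compLinearMap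
        (Submodule.inclusion (Submodule.span_mono h)) ≠ 0 := fun hc => by
      have := congrArg (fun ξ => ξ b) hc
      rw [happ] at this
      exact cons_apply_ne_zero h b hσ hωσ (hneg w hwτ) this
    refine ⟨w, ωσ, hωσ, hne, hw, hwτ, rfl, ?_⟩
    rw [AlternatingMap.ray_eq_iff_basis b, happ]
    exact hpos

end PointedCone

end

/-! ### Signs, the square of the differential, and exactness from collapsibility -/

noncomputable section

namespace LatticePolytope

open Module PointedCone

variable {n : ℕ} (P : LatticePolytope n)

theorem cone_fg : P.cone.FG := by
  obtain ⟨S, hS⟩ := P.exists_finset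
  rw [P.cone_eq S hS]
  exact Submodule.fg_span (Set.finite_range _)

variable {P}

theorem FaceOrientations.sign_eq_zero (o : P.FaceOrientations) {k : ℕ} {τ : P.Face k}
    {σ : P.Face (k + 1)} (h : ¬ τ.1 ≤ σ.1) : o.sign τ σ = 0 := dif_neg h

theorem FaceOrientations.sign_eq_or (o : P.FaceOrientations) {k : ℕ} {τ : P.Face k}
    {σ : P.Face (k + 1)} (h : τ.1 ≤ σ.1) : o.sign τ σ = 1 ∨ o.sign τ σ = -1 := by
  rw [FaceOrientations.sign, dif_pos h]
  split_ifs <;> simp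

/-- Expressing the sign through a product of real numbers allows signs along a chain of faces to be
multiplied. -/
theorem FaceOrientations.sign_mul_pos (o : P.FaceOrientations) {k : ℕ} {τ : P.Face k}
    {σ : P.Face (k + 1)} (h : τ.1 ≤ σ.1) (b : Basis (Fin k) ℝ (coneSpan τ.1))
    {w : coneSpan σ.1} (hw : (w : Fin (n + 1) → ℝ) ∈ σ.1)
    (hwτ : (w : Fin (n + 1) → ℝ) ∉ coneSpan τ.1) :
    0 < (o.sign τ σ : ℝ) * ((o (k + 1) σ).someVector (Fin.cons (-w) (spanIncl h ∘ b)) *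
      (o k τ).someVector b) := by
  have hiff := inducesOrientation_iff h (τ.2.1.of_le σ.2.1 h) b σ.2.2
    (o k τ).someVector_ne_zero (o (k + 1) σ).someVector_ne_zero hw hwτ
  rw [Module.Ray.someVector_ray, Module.Ray.someVector_ray] at hiff
  rw [FaceOrientations.sign, dif_pos h]
  have h1 := cons_apply_ne_zero h b σ.2.2 (o (k + 1) σ).someVector_ne_zero (w := -w)
    (fun hc => hwτ (by simpa using hc))
  have h2 := AlternatingMap.apply_basis_ne_zero b (o k τ).someVector_ne_zero
  split_ifs with hi
  · simpa using hiff.1 hi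
  · have h3 := lt_of_le_of_ne (not_lt.1 fun hc => hi (hiff.2 hc)) (mul_ne_zero h1 h2)
    push_cast
    linarith

/-- With the basis of τ formed from −w and b, the form orienting τ enters squared and drops out:
only the forms of ρ and σ and the two normals matter. -/
theorem FaceOrientations.sign_mul_sign_mul_pos (o : P.FaceOrientations) {k : ℕ} {ρ : P.Face k}
    {τ : P.Face (k + 1)} {σ : P.Face (k + 1 + 1)} (h : ρ.1 ≤ τ.1) (h' : τ.1 ≤ σ.1)
    (b : Basis (Fin k) ℝ (coneSpan ρ.1)) {w w' : coneSpan σ.1}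
    (hw : (w : Fin (n + 1) → ℝ) ∈ τ.1) (hwρ : (w : Fin (n + 1) → ℝ) ∉ coneSpan ρ.1)
    (hw' : (w' : Fin (n + 1) → ℝ) ∈ σ.1) (hwτ : (w' : Fin (n + 1) → ℝ) ∉ coneSpan τ.1) :
    0 < ((o.sign ρ τ : ℝ) * (o.sign τ σ : ℝ)) *
      ((o (k + 1 + 1) σ).someVector
        (Fin.cons (-w') (Fin.cons (-w) (spanIncl (h.trans h') ∘ b))) *
      (o k ρ).someVector b) := by
  let u : coneSpan τ.1 := ⟨w, mem_coneSpan hw⟩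
  obtain ⟨b', hb'⟩ := exists_basis_cons h b τ.2.2 (w := -u) (fun hc => hwρ (by simpa [u] using hc))
  have h1 := o.sign_mul_pos h b (w := u) hw hwρ
  have h2 := o.sign_mul_pos h' b' hw' hwτ
  rw [← hb'] at h1
  have hcons : (spanIncl h' ∘ b' : Fin (k + 1) → coneSpan σ.1) =
      Fin.cons (-w) (spanIncl (h.trans h') ∘ b) := by
    rw [hb']
    funext i
    refine Fin.cases ?_ (fun j => ?_) i
    · rfl
    · rfl
  rw [hcons] at h2
  have h3 := mul_pos h1 h2
  have h4 : 0 < ((o (k + 1) τ).someVector b') ^ 2 :=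
    sq_pos_of_ne_zero (AlternatingMap.apply_basis_ne_zero b' (o (k + 1) τ).someVector_ne_zero)
  refine pos_of_mul_pos_left (b := ((o (k + 1) τ).someVector b') ^ 2) ?_ h4.le
  linarith

theorem alternating_cons_swap {F : Type*} [AddCommGroup F] [Module ℝ F] {k : ℕ}
    (ω : F [⋀^Fin (k + 1 + 1)]→ₗ[ℝ] ℝ) (x y : F) (z : Fin k → F) :
    ω (Fin.cons x (Fin.cons y z)) = -ω (Fin.cons y (Fin.cons x z)) := by
  rw [← ω.map_swap (Fin.cons y (Fin.cons x z)) (i := 0) (j := 1) (by simp)]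
  congr 1
  funext i
  refine Fin.cases ?_ (fun j => Fin.cases ?_ (fun l => ?_) j) i
  · rw [Function.comp_apply, Equiv.swap_apply_left]
    rfl
  · rw [Function.comp_apply, show Fin.succ (0 : Fin (k + 1)) = 1 from rfl, Equiv.swap_apply_right]
    rfl
  · rw [Function.comp_apply, Equiv.swap_apply_of_ne_of_ne]
    · rfl
    · exact Fin.succ_ne_zero _
    · exact fun h => Fin.succ_ne_zero l (Fin.succ_injective _ h)

/-- The signs of the two paths from `σ` to a face of codimension two cancel. -/
theorem FaceOrientations.sum_sign_mul_sign (o : P.FaceOrientations) {k : ℕ} (ρ : P.Face k)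
    (σ : P.Face (k + 1 + 1)) : ∑ τ : P.Face (k + 1), o.sign ρ τ * o.sign τ σ = 0 := by
  by_cases hρσ : ρ.1 ≤ σ.1
  swap
  · refine Finset.sum_eq_zero fun τ _ => ?_
    by_cases h : ρ.1 ≤ τ.1
    · rw [o.sign_eq_zero (fun h' => hρσ (h.trans h')), mul_zero]
    · rw [o.sign_eq_zero h, zero_mul]
  have hρ := ρ.2.1.of_le σ.2.1 hρσ
  have hσfg := σ.2.1.fg P.cone_fg
  have hdρ : dim ρ.1 = k := ρ.2.2
  obtain ⟨τ₁, τ₂, hne, ⟨h1, hρ1, hd1⟩, ⟨h2, hρ2, hd2⟩, hall⟩ :=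
    hρ.exists_two_between hσfg (by rw [hdρ]; exact σ.2.2)
  let t₁ : P.Face (k + 1) := ⟨τ₁, h1.trans σ.2.1, hd1.trans (by rw [hdρ])⟩
  let t₂ : P.Face (k + 1) := ⟨τ₂, h2.trans σ.2.1, hd2.trans (by rw [hdρ])⟩
  have hex : ∀ τ : PointedCone ℝ (Fin (n + 1) → ℝ), dim τ = dim ρ.1 + 1 → ∃ w ∈ τ, w ∉ ρ.1 := by
    intro τ hτ
    by_contra! hc
    have : dim τ ≤ dim ρ.1 := Submodule.finrank_mono (coneSpan_mono hc)
    omega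
  -- If w lay in both facets, their intersection would be strictly larger than ρ, hence equal to
  -- each of them by dimension.
  have hout : ∀ τ τ' : PointedCone ℝ (Fin (n + 1) → ℝ), τ.IsFaceOf σ.1 → τ'.IsFaceOf σ.1 →
      ρ.1 ≤ τ → ρ.1 ≤ τ' → dim τ = dim ρ.1 + 1 → dim τ' = dim ρ.1 + 1 → τ ≠ τ' →
      ∀ w ∈ τ, w ∉ ρ.1 → w ∉ coneSpan τ' := by
    intro τ τ' hτ hτ' hρτ hρτ' hd hd' hne w hw hwρ hc
    have hw' : w ∈ τ' := hτ'.mem_of_mem_coneSpan (hτ.le hw) hc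
    have hinf : (τ ⊓ τ').IsFaceOf σ.1 := hτ.inf_left hτ'
    have hlt : dim _ < dim _ := (hρ.of_le hinf (le_inf hρτ hρτ')).finrank_lt ⟨hw, hw'⟩ hwρ
    have e1 := (hinf.of_le hτ inf_le_left).eq_of_finrank_le (by simp only [dim] at *; omega)
    have e2 := (hinf.of_le hτ' inf_le_right).eq_of_finrank_le (by simp only [dim] at *; omega)
    exact hne (e1.symm.trans e2)
  obtain ⟨w₁, hw₁, hw₁ρ⟩ := hex τ₁ hd1
  obtain ⟨w₂, hw₂, hw₂ρ⟩ := hex τ₂ hd2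
  have hns : ∀ w ∈ σ.1, w ∉ ρ.1 → w ∉ coneSpan ρ.1 :=
    fun w hw hwρ hc => hwρ (hρ.mem_of_mem_coneSpan hw hc)
  let b : Basis (Fin k) ℝ (coneSpan ρ.1) := finBasisOfFinrankEq ℝ _ ρ.2.2
  have p1 := o.sign_mul_sign_mul_pos (ρ := ρ) (τ := t₁) (σ := σ) hρ1 h1.le b
    (w := ⟨w₁, mem_coneSpan (h1.le hw₁)⟩) (w' := ⟨w₂, mem_coneSpan (h2.le hw₂)⟩) hw₁
    (hns _ (h1.le hw₁) hw₁ρ) (h2.le hw₂) (hout _ _ h2 h1 hρ2 hρ1 hd2 hd1 hne.symm _ hw₂ hw₂ρ)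
  have p2 := o.sign_mul_sign_mul_pos (ρ := ρ) (τ := t₂) (σ := σ) hρ2 h2.le b
    (w := ⟨w₂, mem_coneSpan (h2.le hw₂)⟩) (w' := ⟨w₁, mem_coneSpan (h1.le hw₁)⟩) hw₂
    (hns _ (h2.le hw₂) hw₂ρ) (h1.le hw₁) (hout _ _ h1 h2 hρ1 hρ2 hd1 hd2 hne _ hw₁ hw₁ρ)
  -- Each of w₁, w₂ is an inner normal along one path at the step where the other is along the
  -- second path, so the same form occurs with its first two arguments exchanged and the sign
  -- products are opposite.
  rw [alternating_cons_swap] at p2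
  have hne' : t₁ ≠ t₂ := fun h => hne (congrArg Subtype.val h)
  rw [Fintype.sum_eq_add t₁ t₂ hne']
  · rcases o.sign_eq_or (τ := ρ) (σ := t₁) hρ1 with e1 | e1 <;>
    rcases o.sign_eq_or (τ := t₁) (σ := σ) h1.le with e2 | e2 <;>
    rcases o.sign_eq_or (τ := ρ) (σ := t₂) hρ2 with e3 | e3 <;>
    rcases o.sign_eq_or (τ := t₂) (σ := σ) h2.le with e4 | e4 <;>
    rw [e1, e2] at p1 <;> rw [e3, e4] at p2 <;> rw [e1, e2, e3, e4] <;> push_cast at p1 p2 <;>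
    first
    | (norm_num; done)
    | (exfalso; linarith)
  · rintro τ ⟨hτ1, hτ2⟩
    by_cases h : ρ.1 ≤ τ.1
    · by_cases h' : τ.1 ≤ σ.1
      · rcases hall τ.1 (τ.2.1.of_le σ.2.1 h') h (by rw [hdρ]; exact τ.2.2) with e | e
        · exact absurd (Subtype.ext e) hτ1
        · exact absurd (Subtype.ext e) hτ2
      · rw [o.sign_eq_zero h', mul_zero]
    · rw [o.sign_eq_zero h, zero_mul]

variable (P)

theorem differential_apply (o : P.FaceOrientations) (R : Fin (n + 1) → ℤ) {k : ℕ}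
    (c : P.Chain R (k + 1)) (τ : P.Face k) :
    (P.differential o R k c τ : Fin (n + 1) → ℂ) =
      ∑ σ : P.Face (k + 1), o.sign τ σ • (c σ : Fin (n + 1) → ℂ) := by
  rw [differential, LinearMap.pi_apply, LinearMap.sum_apply, AddSubmonoidClass.coe_finsetSum]
  refine Finset.sum_congr rfl fun σ _ => ?_
  split_ifs with h
  · rfl
  · rw [o.sign_eq_zero h, zero_smul]
    rfl

theorem differential_differential (o : P.FaceOrientations) (R : Fin (n + 1) → ℤ) {k : ℕ}
    (c : P.Chain R (k + 1 + 1)) :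
    P.differential o R k (P.differential o R (k + 1) c) = 0 := by
  funext ρ
  ext1
  rw [differential_apply]
  simp_rw [differential_apply, Finset.smul_sum, smul_smul]
  rw [Finset.sum_comm]
  simp_rw [← Finset.sum_smul, o.sum_sign_mul_sign]
  simp

/-- The cycles of the complex; in degree zero, all chains. -/
def IsCycle (o : P.FaceOrientations) (R : Fin (n + 1) → ℤ) : ∀ k : ℕ, P.Chain R k → Prop
  | 0, _ => True
  | k + 1, c => P.differential o R k c = 0

theorem IsCycle.sub_differential {P : LatticePolytope n} {o : P.FaceOrientations}
    {R : Fin (n + 1) → ℤ} {k : ℕ} {c : P.Chain R k} (hc : P.IsCycle o R k c)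
    (b : P.Chain R (k + 1)) : P.IsCycle o R k (c - P.differential o R k b) := by
  cases k with
  | zero => trivial
  | succ k =>
    change P.differential o R k _ = 0
    rw [map_sub, differential_differential, sub_zero]
    exact hc

/-- A cycle that vanishes on an upper set of faces can be made to vanish on a further collapsible set of
faces, by subtracting a boundary. -/
theorem exists_sub_differential_eq_zero (o : P.FaceOrientations) (R : Fin (n + 1) → ℤ)
    {S : Set (PointedCone ℝ (Fin (n + 1) → ℝ))} (hS : Collapsible dim (P.V R) S)
    (hface : ∀ τ ∈ S, τ.IsFaceOf P.cone) (U : Set (PointedCone ℝ (Fin (n + 1) → ℝ)))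
    (hdisj : Disjoint U S) (hU : ∀ x ∈ U, ∀ y, y.IsFaceOf P.cone → x ≤ y → y ∈ U)
    (hUS : ∀ x ∈ U ∪ S, ∀ y, y.IsFaceOf P.cone → x ≤ y → y ∈ U ∪ S)
    {k : ℕ} (c : P.Chain R k) (hc : P.IsCycle o R k c) (hcU : ∀ τ : P.Face k, τ.1 ∈ U → c τ = 0) :
    ∃ b : P.Chain R (k + 1), ∀ τ : P.Face k, τ.1 ∈ U ∪ S →
      (c - P.differential o R k b) τ = 0 := by
  classical
  induction hS generalizing U c with
  | empty => exact ⟨0, fun τ hτ => by simpa using hcU τ (by simpa using hτ)⟩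
  | single a ha =>
    refine ⟨0, fun τ hτ => ?_⟩
    rw [map_zero, sub_zero]
    rcases hτ with hτ | hτ
    · exact hcU τ hτ
    · ext1
      have h1 := (c τ).2
      have h2 : P.V R τ.1 = ⊥ := by rw [show τ.1 = a from hτ, ha]
      replace h1 := h2.le h1
      exact (Submodule.mem_bot ℂ).1 h1
  | pair a b hab hrk hV =>
    obtain ⟨m, hm⟩ : ∃ m, dim a = m := ⟨_, rfl⟩
    let a' : P.Face m := ⟨a, hface a (by simp), hm⟩
    let b' : P.Face (m + 1) := ⟨b, hface b (by simp), by rw [← hm]; exact hrk⟩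
    have hbU : b ∉ U := fun h => Set.disjoint_left.1 hdisj h (by simp)
    rcases eq_or_ne k m with rfl | hkm
    · let v : P.V R b := ⟨o.sign a' b' • (c a' : Fin (n + 1) → ℂ),
        hV ▸ zsmul_mem (c a').2 _⟩
      refine ⟨Pi.single b' v, fun τ hτ => ?_⟩
      have hd : (P.differential o R k (Pi.single b' v) τ : Fin (n + 1) → ℂ) =
          o.sign τ b' • o.sign a' b' • (c a' : Fin (n + 1) → ℂ) := by
        rw [differential_apply, Finset.sum_eq_single b']
        · rw [Pi.single_eq_same]
        · intro σ _ hσ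
          rw [Pi.single_eq_of_ne hσ]
          simp
        · simp
      ext1
      rw [Pi.sub_apply, Submodule.coe_sub, hd]
      rcases hτ with hτ | hτ | hτ
      -- No face in U lies below b, since U is an upper set without b; the vanishing on U is not
      -- disturbed.
      · rw [hcU τ hτ, o.sign_eq_zero (fun h => hbU (hU _ hτ _ b'.2.1 h))]
        simp
      · obtain rfl : τ = a' := Subtype.ext hτ
        rcases o.sign_eq_or (τ := a') (σ := b') hab with e | e <;> simp [e]
      · have h1 := τ.2.2
        rw [show τ.1 = b from hτ] at h1
        have h2 := b'.2.2
        change finrank ℝ (coneSpan b) = k + 1 at h2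
        omega
    · refine ⟨0, fun τ hτ => ?_⟩
      rw [map_zero, sub_zero]
      rcases hτ with hτ | hτ | hτ
      · exact hcU τ hτ
      · refine absurd ?_ hkm
        rw [← τ.2.2, ← hm, show τ.1 = a from hτ]
      · obtain rfl : k = m + 1 := by
          rw [← τ.2.2, show τ.1 = b from hτ]
          exact b'.2.2
        obtain rfl : τ = b' := Subtype.ext hτ
        -- In the cycle condition at a, every other face of dimension m + 1 above a lies in U, so
        -- the term of b is the only one left.
        have h1 := congrArg (fun z => ((z a' : P.V R a'.1) : Fin (n + 1) → ℂ)) hc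
        simp only [differential_apply] at h1
        rw [Finset.sum_eq_single b'] at h1
        · ext1
          rcases o.sign_eq_or (τ := a') (σ := b') hab with e | e <;> rw [e] at h1 <;>
            simpa using h1
        · intro σ _ hσ
          by_cases h2 : a'.1 ≤ σ.1
          · have h3 := hUS a (by simp) σ.1 σ.2.1 h2
            rcases h3 with h3 | h3 | h3
            · rw [hcU σ h3]
              simp
            · have h4 := σ.2.2
              rw [show σ.1 = a from h3] at h4
              simp only [dim] at hm
              omega
            · exact absurd (Subtype.ext (show σ.1 = b from h3)) hσ
          · rw [o.sign_eq_zero h2, zero_smul]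
        · simp
  | union A B hA hB hAB ihA ihB =>
    rw [Set.disjoint_union_right] at hdisj
    have hUB : ∀ x ∈ U ∪ B, ∀ y, IsFaceOf y P.cone → x ≤ y → y ∈ U ∪ B := by
      intro x hx y hy hxy
      rcases hx with hx | hx
      · exact Or.inl (hU x hx y hy hxy)
      · rcases hUS x (by simp [hx]) y hy hxy with h | h | h
        · exact Or.inl h
        · exact absurd hxy (hAB y h x hx)
        · exact Or.inr h
    -- B is cleared before A: no element of B lies below one of A, so U ∪ B is again an upper set.
    obtain ⟨b₁, hb₁⟩ := ihB (fun τ hτ => hface τ (Or.inr hτ)) U hdisj.2 hU hUB c hc hcU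
    have hassoc : U ∪ B ∪ A = U ∪ (A ∪ B) := by
      rw [Set.union_assoc, Set.union_comm B A]
    obtain ⟨b₂, hb₂⟩ := ihA (fun τ hτ => hface τ (Or.inl hτ)) (U ∪ B)
      (Set.disjoint_union_left.2 ⟨hdisj.1, Set.disjoint_left.2 fun x hx hx' =>
        hAB x hx' x hx le_rfl⟩) hUB (by rw [hassoc]; exact hUS) _ (hc.sub_differential b₁) hb₁
    refine ⟨b₁ + b₂, fun τ hτ => ?_⟩
    rw [map_add, ← sub_sub]
    exact hb₂ τ (by rw [hassoc]; exact hτ)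

/-- The complex is exact if the face lattice is collapsible. -/
theorem exact_of_collapsible (o : P.FaceOrientations) (R : Fin (n + 1) → ℤ)
    (h : Collapsible dim (P.V R) {τ | IsFaceOf τ P.cone}) :
    (∀ k : ℕ, Function.Exact (P.differential o R (k + 1)) (P.differential o R k)) ∧
      Function.Surjective (P.differential o R 0) := by
  have key : ∀ (k : ℕ) (c : P.Chain R k), P.IsCycle o R k c →
      ∃ b, P.differential o R k b = c := by
    intro k c hc
    obtain ⟨b, hb⟩ := P.exists_sub_differential_eq_zero o R h (fun _ h => h) ∅
      (Set.empty_disjoint _) (by simp) (fun x _ y hy _ => Or.inr hy) c hc (by simp)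
    refine ⟨b, (sub_eq_zero.1 ?_).symm⟩
    funext τ
    exact hb τ (Or.inr τ.2.1)
  refine ⟨fun k c => ⟨fun hc => key (k + 1) c hc, ?_⟩, fun c => key 0 c trivial⟩
  rintro ⟨b, rfl⟩
  exact P.differential_differential o R b

end LatticePolytope

end

/-! ### Pairings, lattice vectors and integral forms -/

noncomputable section

open Filter Topology PointedCone

/-- The standard pairing with a fixed vector, as a linear form. -/
def pairing {d : ℕ} (r : Fin d → ℝ) : (Fin d → ℝ) →ₗ[ℝ] ℝ where
  toFun x := x ⬝ᵥ r
  map_add' x y := add_dotProduct x y r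
  map_smul' c x := smul_dotProduct c x r

theorem pairing_apply {d : ℕ} (r x : Fin d → ℝ) : pairing r x = x ⬝ᵥ r := rfl

/-- Around an interior point y, the vector y − εa stays in the dual cone for small ε > 0, and a ⬝ᵥ a
> 0 makes the inequality strict. -/
theorem mem_interior_dualCone_ray {d : ℕ} {a : Fin d → ℝ} (ha : a ≠ 0) {y : Fin d → ℝ} :
    y ∈ interior (dualCone (PointedCone.hull ℝ {a})) ↔ 0 < a ⬝ᵥ y := by
  constructor
  · intro hy
    have ht : Tendsto (fun ε : ℝ => y - ε • a) (𝓝[>] 0) (𝓝 y) := by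
      have : Continuous fun ε : ℝ => y - ε • a := by fun_prop
      simpa using (this.tendsto 0).mono_left nhdsWithin_le_nhds
    obtain ⟨ε, hε, hε0⟩ :=
      ((ht.eventually (mem_interior_iff_mem_nhds.1 hy)).and self_mem_nhdsWithin).exists
    have h1 := hε a (Submodule.subset_span rfl)
    rw [dotProduct_sub, dotProduct_smul, smul_eq_mul] at h1
    have h2 : 0 < a ⬝ᵥ a := lt_of_le_of_ne (Finset.sum_nonneg fun i _ => mul_self_nonneg (a i))
      fun h => ha (dotProduct_self_eq_zero.1 h.symm)
    have h3 := mul_pos (Set.mem_Ioi.1 hε0) h2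
    linarith
  · intro hy
    refine mem_interior.2 ⟨{y | 0 < a ⬝ᵥ y}, fun z hz x hx => ?_, ?_, hy⟩
    · rw [← pairing_apply]
      refine nonneg_of_hull ?_ hx
      rintro _ rfl
      exact le_of_lt hz
    · refine isOpen_lt continuous_const ?_
      unfold dotProduct
      fun_prop

theorem heightOne_ne_zero {n : ℕ} (x : Fin n → ℝ) : heightOne x ≠ 0 := fun h => by
  have := congrFun h (Fin.last n)
  simp [heightOne] at this

theorem heightOne_dotProduct {n : ℕ} (x : Fin n → ℝ) (r : Fin (n + 1) → ℝ) :
    heightOne x ⬝ᵥ r = x ⬝ᵥ (fun i => r i.castSucc) + r (Fin.last n) := by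
  simp [dotProduct, Fin.sum_univ_castSucc, heightOne]

theorem heightOne_latticeReal {n : ℕ} (s : Fin n → ℤ) :
    heightOne (latticeReal s) = latticeReal (Fin.snoc (α := fun _ => ℤ) s 1) := by
  funext i
  refine Fin.lastCases ?_ (fun j => ?_) i <;> simp [heightOne, latticeReal]

theorem latticeReal_dotProduct {d : ℕ} (r s : Fin d → ℤ) :
    latticeReal r ⬝ᵥ latticeReal s = ((r ⬝ᵥ s : ℤ) : ℝ) := by
  simp [latticeReal, dotProduct]

theorem latticeReal_add {d : ℕ} (r s : Fin d → ℤ) :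
    latticeReal (r + s) = latticeReal r + latticeReal s := by
  funext i
  simp [latticeReal]

theorem latticeReal_sub {d : ℕ} (r s : Fin d → ℤ) :
    latticeReal (r - s) = latticeReal r - latticeReal s := by
  funext i
  simp [latticeReal]

theorem latticeReal_smul {d : ℕ} (c : ℤ) (s : Fin d → ℤ) :
    latticeReal (c • s) = (c : ℝ) • latticeReal s := by
  funext i
  simp [latticeReal]

/-- The last coordinate of `ℤ^(n+1)`. -/
def latticeHeight (n : ℕ) : Fin (n + 1) → ℤ := Pi.single (Fin.last n) 1

theorem heightOne_dotProduct_latticeHeight {n : ℕ} (x : Fin n → ℝ) :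
    heightOne x ⬝ᵥ latticeReal (latticeHeight n) = 1 := by
  rw [heightOne_dotProduct]
  have : (fun i : Fin n => latticeReal (latticeHeight n) i.castSucc) = 0 := by
    funext i
    simp [latticeReal, latticeHeight, (Fin.castSucc_lt_last i).ne]
  rw [this]
  simp [latticeReal, latticeHeight]

/-- Finitely many strict linear inequalities with a real solution have an integral solution. -/
theorem exists_int_dotProduct_pos {n : ℕ} {A : Set (Fin n → ℝ)} (hA : A.Finite) (c : Fin n → ℝ)
    (hc : ∀ a ∈ A, 0 < a ⬝ᵥ c) : ∃ m : Fin n → ℤ, ∀ a ∈ A, 0 < a ⬝ᵥ latticeReal m := by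
  have hev : ∀ a ∈ A, ∀ᶠ N : ℝ in atTop, 0 < a ⬝ᵥ latticeReal (fun i => ⌊N * c i⌋) := by
    intro a ha
    filter_upwards [(tendsto_id.atTop_mul_const (hc a ha)).eventually_gt_atTop (∑ i, |a i|)]
      with N hN
    -- Rounding N c down costs at most ∑ |a i|, independently of N.
    have h1 : N * (a ⬝ᵥ c) - ∑ i, |a i| ≤ a ⬝ᵥ latticeReal (fun i => ⌊N * c i⌋) := by
      rw [dotProduct, dotProduct, Finset.mul_sum, ← Finset.sum_sub_distrib]
      refine Finset.sum_le_sum fun i _ => ?_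
      have h2 : a i * Int.fract (N * c i) ≤ |a i| := by
        refine (le_abs_self _).trans ?_
        rw [abs_mul, abs_of_nonneg (Int.fract_nonneg (N * c i))]
        exact mul_le_of_le_one_right (abs_nonneg _) (Int.fract_lt_one _).le
      have h3 : (⌊N * c i⌋ : ℝ) = N * c i - Int.fract (N * c i) := by
        rw [Int.self_sub_fract]
      change N * (a i * c i) - |a i| ≤ a i * (⌊N * c i⌋ : ℝ)
      rw [h3]
      linarith
    simp only [id] at hN
    linarith
  obtain ⟨N, hN⟩ := ((eventually_all_finite hA).2 hev).exists
  exact ⟨_, hN⟩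

theorem span_latticeComplex_eq_top {d : ℕ} {K : Set (Fin d → ℤ)}
    (hK : ∀ m : Fin d → ℤ, latticeComplex m ∈ Submodule.span ℂ (latticeComplex '' K)) :
    Submodule.span ℂ (latticeComplex '' K) = ⊤ := by
  rw [eq_top_iff]
  intro z _
  rw [pi_eq_sum_univ z]
  refine Submodule.sum_mem _ fun i _ => Submodule.smul_mem _ _ ?_
  convert hK (fun j => if i = j then 1 else 0) using 1
  funext j
  simp [latticeComplex]

theorem hull_heightOne_convexHull {n : ℕ} (T : Set (Fin n → ℝ)) :
    PointedCone.hull ℝ (heightOne '' convexHull ℝ T) = PointedCone.hull ℝ (heightOne '' T) := by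
  refine le_antisymm (Submodule.span_le.2 ?_)
    (Submodule.span_mono (Set.image_mono (subset_convexHull ℝ T)))
  rintro _ ⟨x, hx, rfl⟩
  have hconv : Convex ℝ {x : Fin n → ℝ | heightOne x ∈ PointedCone.hull ℝ (heightOne '' T)} := by
    intro x hx y hy a b ha hb hab
    have : heightOne (a • x + b • y) = a • heightOne x + b • heightOne y := by
      funext i
      refine Fin.lastCases ?_ (fun j => ?_) i <;> simp [heightOne, hab]
    simp only [Set.mem_ofPred_eq] at hx hy ⊢
    rw [this]
    exact add_mem (PointedCone.smul_mem _ ha hx) (PointedCone.smul_mem _ hb hy)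
  have hT : T ⊆ {x : Fin n → ℝ | heightOne x ∈ PointedCone.hull ℝ (heightOne '' T)} :=
    fun t ht => Submodule.subset_span (Set.mem_image_of_mem _ ht)
  exact convexHull_min hT hconv hx

/-! ### The spaces V^R in terms of the excess, and the matching on the face fan -/

namespace LatticePolytope

variable {n : ℕ} (P : LatticePolytope n)

/-- The vertices of a lattice polytope. -/
abbrev vertices : Set (Fin n → ℝ) := P.carrier.extremePoints ℝ

theorem exists_lattice_carrier : ∃ S : Set (Fin n → ℤ), S.Finite ∧
    P.carrier = convexHull ℝ (latticeReal '' S) := by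
  obtain ⟨S, hS⟩ := P.exists_finset
  exact ⟨S, S.finite_toSet, hS⟩

theorem vertices_subset {S : Set (Fin n → ℤ)} (hS : P.carrier = convexHull ℝ (latticeReal '' S)) :
    P.vertices ⊆ latticeReal '' S := by
  rw [vertices, hS]
  exact extremePoints_convexHull_subset

theorem vertices_finite : P.vertices.Finite := by
  obtain ⟨S, hS, h⟩ := P.exists_lattice_carrier
  exact (hS.image _).subset (P.vertices_subset h)

/-- This is the Krein–Milman theorem; no closure is needed, because the vertices are finitely many.
-/
theorem convexHull_vertices : convexHull ℝ P.vertices = P.carrier := by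
  obtain ⟨S, hS, h⟩ := P.exists_lattice_carrier
  have hc : IsCompact P.carrier := by
    rw [h]
    exact (hS.image _).isCompact_convexHull ℝ
  have hconv : Convex ℝ P.carrier := by
    rw [h]
    exact convex_convexHull ℝ _
  rw [← closure_convexHull_extremePoints hc hconv]
  exact (P.vertices_finite.isCompact_convexHull ℝ).isClosed.closure_eq.symm

theorem cone_eq_hull_vertices : P.cone = PointedCone.hull ℝ (heightOne '' P.vertices) := by
  rw [cone, ← P.convexHull_vertices, hull_heightOne_convexHull]

theorem mem_dualCone_cone {S : Set (Fin n → ℤ)} (hS : P.carrier = convexHull ℝ (latticeReal '' S))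
    {r : Fin (n + 1) → ℝ} (h : ∀ s ∈ S, 0 ≤ heightOne (latticeReal s) ⬝ᵥ r) :
    r ∈ dualCone P.cone := by
  intro x hx
  rw [cone, hS, hull_heightOne_convexHull] at hx
  rw [← pairing_apply]
  refine nonneg_of_hull ?_ hx
  rintro _ ⟨_, ⟨s, hs, rfl⟩, rfl⟩
  exact h s hs

/-- A vertex has an integral supporting form. -/
theorem exists_supporting {S : Set (Fin n → ℤ)} (hS : S.Finite)
    (hP : P.carrier = convexHull ℝ (latticeReal '' S)) {v : Fin n → ℤ}
    (hv : latticeReal v ∈ P.vertices) :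
    ∃ r : Fin (n + 1) → ℤ, heightOne (latticeReal v) ⬝ᵥ latticeReal r = 0 ∧
      ∀ s ∈ S, latticeReal s ≠ latticeReal v → 1 ≤ heightOne (latticeReal s) ⬝ᵥ latticeReal r := by
  let T : Set (Fin n → ℝ) := latticeReal '' S \ {latticeReal v}
  have hT : T.Finite := (hS.image _).subset Set.sdiff_subset
  have hvT : latticeReal v ∉ convexHull ℝ T := by
    have hconv := ((hP ▸ convex_convexHull ℝ _ :
      Convex ℝ P.carrier).mem_extremePoints_iff_convex_sdiff.1 hv).2
    intro hc
    have hsub : T ⊆ P.carrier \ {latticeReal v} := by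
      rw [hP]
      exact Set.sdiff_subset_sdiff_left (subset_convexHull ℝ _)
    exact (convexHull_min hsub hconv hc).2 rfl
  obtain ⟨f, u, hfv, hfT⟩ := geometric_hahn_banach_point_closed (convex_convexHull ℝ T)
    (hT.isCompact_convexHull ℝ).isClosed hvT
  let c : Fin n → ℝ := fun i => f (fun j => if i = j then 1 else 0)
  have hfc : ∀ x, f x = x ⬝ᵥ c := fun x => (f : (Fin n → ℝ) →ₗ[ℝ] ℝ).pi_apply_eq_sum_univ x
  -- The separating form is replaced by an integral one that is still positive on the differences s
  -- − v; integrality then improves "positive" to "at least 1".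
  obtain ⟨m, hm⟩ := exists_int_dotProduct_pos (hT.image (fun x => x - latticeReal v)) c (by
    rintro _ ⟨x, hx, rfl⟩
    rw [sub_dotProduct, ← hfc, ← hfc]
    have := hfT x (subset_convexHull ℝ _ hx)
    linarith)
  have hval : ∀ x : Fin n → ℝ, heightOne x ⬝ᵥ
      latticeReal (Fin.snoc (α := fun _ => ℤ) m (-(v ⬝ᵥ m))) =
      x ⬝ᵥ latticeReal m - latticeReal v ⬝ᵥ latticeReal m := by
    intro x
    rw [heightOne_dotProduct, latticeReal_dotProduct]
    simp [latticeReal, sub_eq_add_neg]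
    rfl
  refine ⟨Fin.snoc (α := fun _ => ℤ) m (-(v ⬝ᵥ m)), ?_, fun s hs hsv => ?_⟩
  · rw [hval, sub_self]
  · have h1 := hm _ ⟨latticeReal s, ⟨⟨s, hs, rfl⟩, hsv⟩, rfl⟩
    rw [hval]
    rw [sub_dotProduct, latticeReal_dotProduct, latticeReal_dotProduct] at *
    exact_mod_cast h1

/-- The linear form `R - 1`, with `1` the height. -/
def excess (R : Fin (n + 1) → ℤ) : (Fin (n + 1) → ℝ) →ₗ[ℝ] ℝ :=
  pairing (latticeReal R - latticeReal (latticeHeight n))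

theorem excess_heightOne (R : Fin (n + 1) → ℤ) (x : Fin n → ℝ) :
    excess R (heightOne x) = heightOne x ⬝ᵥ latticeReal R - 1 := by
  rw [excess, pairing_apply, dotProduct_sub, heightOne_dotProduct_latticeHeight]

theorem mem_K_ray {R r : Fin (n + 1) → ℤ} {v : Fin n → ℝ} :
    r ∈ P.K R (PointedCone.hull ℝ {heightOne v}) ↔
      latticeReal r ∈ dualCone P.cone ∧
        heightOne v ⬝ᵥ latticeReal r < heightOne v ⬝ᵥ latticeReal R := by
  rw [K, Set.mem_ofPred_eq, mem_interior_dualCone_ray (heightOne_ne_zero v), latticeReal_sub,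
    dotProduct_sub, sub_pos]

/-- By integrality ⟨a, R⟩ < 1 means ⟨a, R⟩ ≤ 0, which leaves no r with 0 ≤ ⟨a, r⟩ < ⟨a, R⟩. -/
theorem span_K_eq_bot {R : Fin (n + 1) → ℤ} {v : Fin n → ℝ} (hv : v ∈ P.vertices)
    (h : excess R (heightOne v) < 0) :
    Submodule.span ℂ (latticeComplex '' P.K R (PointedCone.hull ℝ {heightOne v})) = ⊥ := by
  obtain ⟨S, -, hP⟩ := P.exists_lattice_carrier
  have hvc : heightOne v ∈ P.cone := Submodule.subset_span ⟨v, hv.1, rfl⟩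
  obtain ⟨s, -, rfl⟩ := P.vertices_subset hP hv
  have hempty : P.K R (PointedCone.hull ℝ {heightOne (latticeReal s)}) = ∅ := by
    rw [Set.eq_empty_iff_forall_notMem]
    intro r hr
    rw [mem_K_ray] at hr
    have h1 := lt_of_le_of_lt (hr.1 _ hvc) hr.2
    rw [excess_heightOne, sub_neg] at h
    rw [heightOne_latticeReal, latticeReal_dotProduct] at h h1
    norm_cast at h h1
    omega
  rw [hempty, Set.image_empty, Submodule.span_empty]

/-- Since ⟨a, R⟩ > 1, both the height and a form r supporting σ along the ray of a lie in K.
Subtracting a multiple of the height from a lattice vector m gives m' vanishing at a, and m' + N r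
lies in K for large N, so m is in the span. -/
theorem span_K_eq_top {R : Fin (n + 1) → ℤ} {v : Fin n → ℝ} (hv : v ∈ P.vertices)
    (h : 0 < excess R (heightOne v)) :
    Submodule.span ℂ (latticeComplex '' P.K R (PointedCone.hull ℝ {heightOne v})) = ⊤ := by
  obtain ⟨S, hS, hP⟩ := P.exists_lattice_carrier
  obtain ⟨v, -, rfl⟩ := P.vertices_subset hP hv
  obtain ⟨r, hrv, hr⟩ := P.exists_supporting hS hP hv
  rw [excess_heightOne, sub_pos] at h
  set K := P.K R (PointedCone.hull ℝ {heightOne (latticeReal v)}) with hK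
  have hmem : ∀ q, q ∈ K → latticeComplex q ∈ Submodule.span ℂ (latticeComplex '' K) :=
    fun q hq => Submodule.subset_span ⟨q, hq, rfl⟩
  have heK : latticeHeight n ∈ K := by
    rw [hK, mem_K_ray, heightOne_dotProduct_latticeHeight]
    refine ⟨P.mem_dualCone_cone hP fun s _ => ?_, h⟩
    rw [heightOne_dotProduct_latticeHeight]
    exact zero_le_one
  have hrK : r ∈ K := by
    rw [hK, mem_K_ray, hrv]
    refine ⟨P.mem_dualCone_cone hP fun s hs => ?_, by linarith⟩
    by_cases hsv : latticeReal s = latticeReal v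
    · rw [hsv, hrv]
    · exact zero_le_one.trans (hr s hs hsv)
  refine span_latticeComplex_eq_top fun m => ?_
  obtain ⟨a, ha⟩ : ∃ a : ℤ, heightOne (latticeReal v) ⬝ᵥ latticeReal m = a := by
    rw [heightOne_latticeReal, latticeReal_dotProduct]
    exact ⟨_, rfl⟩
  have hm' : heightOne (latticeReal v) ⬝ᵥ latticeReal (m - a • latticeHeight n) = 0 := by
    rw [latticeReal_sub, latticeReal_smul, dotProduct_sub, dotProduct_smul,
      heightOne_dotProduct_latticeHeight, ha]
    simp
  set m' := m - a • latticeHeight n with hm'def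
  obtain ⟨N, hN⟩ : ∃ N : ℕ, ∀ s ∈ S, -(heightOne (latticeReal s) ⬝ᵥ latticeReal m') ≤ N := by
    obtain ⟨B, hB⟩ := (hS.image fun s => -(heightOne (latticeReal s) ⬝ᵥ latticeReal m')).bddAbove
    obtain ⟨N, hN⟩ := exists_nat_ge B
    exact ⟨N, fun s hs => (hB ⟨s, hs, rfl⟩).trans hN⟩
  have hqval : ∀ x, x ⬝ᵥ latticeReal (m' + (N : ℤ) • r) =
      x ⬝ᵥ latticeReal m' + N * (x ⬝ᵥ latticeReal r) := by
    intro x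
    rw [latticeReal_add, latticeReal_smul, dotProduct_add, dotProduct_smul]
    simp
  have hqK : m' + (N : ℤ) • r ∈ K := by
    rw [hK, mem_K_ray, hqval, hm', hrv]
    refine ⟨P.mem_dualCone_cone hP fun s hs => ?_, by linarith⟩
    rw [hqval]
    by_cases hsv : latticeReal s = latticeReal v
    · rw [hsv, hrv, hm']
      simp
    · have h1 := hN s hs
      have h2 := mul_le_mul_of_nonneg_left (hr s hs hsv) (Nat.cast_nonneg (α := ℝ) N)
      linarith
  have hdecomp : latticeComplex m = latticeComplex (m' + (N : ℤ) • r) -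
      (N : ℂ) • latticeComplex r + (a : ℂ) • latticeComplex (latticeHeight n) := by
    funext i
    simp [latticeComplex, hm'def]
  rw [hdecomp]
  exact add_mem (sub_mem (hmem _ hqK) (Submodule.smul_mem _ _ (hmem _ hrK)))
    (Submodule.smul_mem _ _ (hmem _ heK))

/-- A face is generated by the vertices in it, so a negative value of the excess already occurs at
one of them, and its span is zero. -/
theorem V_eq_bot {R : Fin (n + 1) → ℤ} {τ : PointedCone ℝ (Fin (n + 1) → ℝ)}
    (hτ : τ.IsFaceOf P.cone) (h : ∃ x ∈ τ, excess R x < 0) : P.V R τ = ⊥ := by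
  obtain ⟨x, hx, hlt⟩ := h
  rw [hτ.eq_hull (P.vertices_finite.image _) P.cone_eq_hull_vertices] at hx
  obtain ⟨v, hv, hvτ, hneg⟩ : ∃ v ∈ P.vertices, heightOne v ∈ τ ∧ excess R (heightOne v) < 0 := by
    by_contra! hc
    refine absurd (nonneg_of_hull ?_ hx) (not_le.2 hlt)
    rintro _ ⟨⟨v, hv, rfl⟩, hvτ⟩
    exact hc v hv hvτ
  rw [eq_bot_iff, ← P.span_K_eq_bot hv hneg]
  exact iInf₂_le (f := fun v (_ : v ∈ {v | v ∈ P.carrier.extremePoints ℝ ∧ heightOne v ∈ τ}) =>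
    Submodule.span ℂ (latticeComplex '' P.K R (PointedCone.hull ℝ {heightOne v}))) v ⟨hv, hvτ⟩

/-- The vertices in τ but not in ρ have positive excess and impose no condition on the intersection.
-/
theorem V_eq_of_mem_positiveFaces {R : Fin (n + 1) → ℤ}
    {τ ρ : PointedCone ℝ (Fin (n + 1) → ℝ)} (hτ : τ ∈ positiveFaces P.cone ρ (excess R)) :
    P.V R τ = P.V R ρ := by
  refine le_antisymm (P.V_anti R hτ.2.1) (le_iInf₂ fun v hv => ?_)
  by_cases hvρ : heightOne v ∈ ρ
  · exact iInf₂_le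
      (f := fun v (_ : v ∈ {v | v ∈ P.carrier.extremePoints ℝ ∧ heightOne v ∈ ρ}) =>
      Submodule.span ℂ (latticeComplex '' P.K R (PointedCone.hull ℝ {heightOne v}))) v ⟨hv.1, hvρ⟩
  · rw [P.span_K_eq_top hv.1 (hτ.2.2 _ hv.2 hvρ)]
    exact le_top

theorem collapsible_faces {R : Fin (n + 1) → ℤ} (hR : ∃ x ∈ P.cone, 0 < excess R x) :
    Collapsible dim (P.V R) {τ | IsFaceOf τ P.cone} := by
  have hfin := finite_faces P.cone_fg
  -- The target is `Prop`, ordered by implication: taking a negative value passes to larger faces.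
  refine Collapsible.of_fibers (fun τ => ∃ x ∈ τ, excess R x < 0) hfin ?_ fun a ha => ?_
  · rintro τ - τ' - h ⟨x, hx, hlt⟩
    exact ⟨x, h hx, hlt⟩
  by_cases hneg : ∃ x ∈ a, excess R x < 0
  · refine Collapsible.of_forall_eq_bot (hfin.subset (Set.sep_subset _ _)) ?_
    rintro τ ⟨hτ, heq⟩
    exact P.V_eq_bot hτ (heq.symm ▸ hneg)
  · have hset : {τ ∈ {τ | IsFaceOf τ P.cone} |
        (∃ x ∈ τ, excess R x < 0) = ∃ x ∈ a, excess R x < 0} =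
        {τ | IsFaceOf τ P.cone ∧ ∀ x ∈ τ, 0 ≤ excess R x} := by
      ext τ
      simp [hneg]
    rw [hset]
    -- On the remaining faces, the fibre over ρ is `positiveFaces P.cone ρ (excess R)`, where the
    -- coefficients are constantly V_ρ.
    refine Collapsible.of_fibers (fun τ => zeroLocus τ (excess R))
      (hfin.subset (Set.sep_subset _ _)) ?_ ?_
    · intro τ _ τ' _ h
      exact inf_le_inf_right _ h
    · rintro b ⟨hb, hb0⟩
      have hρ : (zeroLocus b (excess R)).IsFaceOf P.cone := (zeroLocus_isFaceOf hb0).trans hb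
      have hρ0 : ∀ x ∈ zeroLocus b (excess R), excess R x = 0 := fun x hx => hx.2
      convert collapsible_positiveFaces P.cone_fg hρ hρ0 hR
        (fun τ hτ => P.V_eq_of_mem_positiveFaces hτ) using 1
      ext τ
      constructor
      · rintro ⟨⟨hτ, hτ0⟩, heq⟩
        refine ⟨hτ, heq ▸ inf_le_left, fun x hx hxρ => lt_of_le_of_ne (hτ0 x hx) fun h0 => hxρ ?_⟩
        rw [← heq]
        exact ⟨hx, h0.symm⟩
      · rintro ⟨hτ, hle, hpos⟩
        refine ⟨⟨hτ, fun x hx => ?_⟩, le_antisymm (fun x hx => ?_) fun x hx => ⟨hle hx, hx.2⟩⟩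
        · by_cases hxρ : x ∈ zeroLocus b (excess R)
          · exact (hρ0 x hxρ).ge
          · exact (hpos x hx hxρ).le
        · by_contra hxρ
          exact (hpos x hx.1 hxρ).ne' hx.2

end LatticePolytope

end

/-- The complex `⋯ → C₂ → C₁ → C₀ → 0` of the homological system `V^R` on the face fan of `cone(Δ)`
is exact, in every degree and for every choice of orientations. -/
theorem proposition6p6 {n : ℕ} (P : LatticePolytope n) (R : Fin (n + 1) → ℤ)
    (hR : ¬ ∀ x ∈ P.carrier, heightOne x ⬝ᵥ latticeReal R ≤ 1) (o : P.FaceOrientations) :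
    (∀ k : ℕ, Function.Exact (P.differential o R (k + 1)) (P.differential o R k)) ∧
      Function.Surjective (P.differential o R 0) := by
  refine P.exact_of_collapsible o R (P.collapsible_faces ?_)
  push Not at hR
  obtain ⟨x, hx, hlt⟩ := hR
  refine ⟨heightOne x, Submodule.subset_span ⟨x, hx, rfl⟩, ?_⟩
  rw [LatticePolytope.excess_heightOne]
  linarith
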